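/- Let $R$ be a commutative ring. All modules are $(\mathbb Z,\mathbb Z)$-bigraded $R$-modules $A=\{A_i^j\}$ ($i$ horizontal, $j$ vertical degree), with Koszul signs $(-1)^{\langle x,y\rangle}$, where $\langle (x_1,x_2),(y_1,y_2)\rangle=x_1y_1+x_2y_2$. A \emph{derived $A_\infty$-algebra} is a bigraded module $A$ with linear maps $m_{ij}\colon A^{\otimes j}\to A$ of bidegree $(i,2-(i+j))$ for $i\ge 0$, $j\ge 1$, such that for all $u\ge 0$, $v\ge 1$ $$\sum_{\substack{u=i+p,\ v=j+q-1\\ j=r+1+t}}(-1)^{rq+t+pj}\,m_{ij}(1^{\otimes r}\otimes m_{pq}\otimes 1^{\otimes t})=0 .$$ Let $\mathcal O$ be a nonsymmetric operad in bigraded $R$-modules which is horizontally bounded on the right (for every $n$, $\mathcal O(n)_i^j=0$ for all sufficiently large $i$ and all $j$). Let a derived $A_\infty$-multiplication $m=\sum m_{ij}$ on $\mathcal O$ be given, i.e. a map of operads $d\mathcal A_\infty\to\mathcal O$, where $d\mathcal A_\infty$ is the bigraded operad generated by elements $m_{ij}$ ($i\ge0$, $j\ge1$) of arity $j$ and bidegree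 $(i,2-(i+j))$ subject to the relations $\sum(-1)^{rq+t+pj}\gamma(m_{ij};1^r,m_{pq},1^t)=0$ (same sums as above); the images of the generators are again denoted $m_{ij}\in\mathcal O(j)$. Let $\mathfrak s\mathcal O$ be the vertical operadic suspension: $\mathfrak s\mathcal O(n)=\mathcal O(n)\otimes\Lambda(n)$ with diagonal composition, where $\Lambda(n)=R\,e^n$ is concentrated in bidegree $(0,n-1)$ and $e^n\circ_i e^m=(-1)^{(n-i)(m-1)}e^{n+m-1}$. Its underlying bigraded module is $\prod_n\mathfrak s\mathcal O(n)$ (the product taken in each bidegree), and its braces are $$b_j(x;y_1,\dots,y_j)=\sum\tilde\gamma(x;1,\dots,1,y_1,1,\dots,1,y_j,1,\dots,1),$$ summed over all order-preserving insertions, where $\tilde\gamma$ is the composition of $\mathfrak s\mathcal O$. Let $A=S\mathfrak s\mathcal O$ with $S$ the vertical shift, $(SB)_i^j=B_i^{j-1}$. For homogeneous $x_v=Sy_v\in A$, with $y_v$ of bidegree $(k_v,d_v-k_v)$ in $\mathfrak s\mathcal O$, put $$M_{ij}(x_1,\dots,x_j)=(-1)^{\sum_{v=1}^j(j-v)(d_v-k_v)}\sum_l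 S\,b_j(m_{il};y_1,\dots,y_j)\qquad(i\ge 0,\ j\ge2),$$ and for $x\in A_k^{d-k}$ put $$M_{i1}(x)=\sum_l\Bigl(S\,b_1(m_{il};S^{-1}x)-(-1)^{ik+(1-i)(d-1-k)}S\,b_1(S^{-1}x;m_{il})\Bigr)\qquad(i\ge0).$$ Then these formulas determine a derived $A_\infty$-algebra structure on $A=S\mathfrak s\mathcal O$: there is exactly one derived $A_\infty$-algebra structure on $A$ whose structure maps are given by them. -/

import Mathlib

universe u v w

namespace DerivedOperad

/-- The scalar product `⟨p, q⟩` of two bidegrees, which governs the Koszul signs.  A bidegree is a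
pair (horizontal degree, vertical degree). -/
def pairing (p q : ℤ × ℤ) : ℤ := p.1 * q.1 + p.2 * q.2

/-- A `(ℤ, ℤ)`-bigraded `R`-module. -/
structure BigradedModule (R : Type v) [CommRing R] where
  obj : ℤ × ℤ → Type u
  [addCommGroup : ∀ p, AddCommGroup (obj p)]
  [module : ∀ p, Module R (obj p)]

attribute [instance] BigradedModule.addCommGroup BigradedModule.module

namespace BigradedModule

variable {R : Type v} [CommRing R]

/-- The direct sum of all the homogeneous components. -/
abbrev Total (A : BigradedModule.{u} R) : Type u := DirectSum (ℤ × ℤ) A.obj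

/-- A homogeneous element of bidegree `p`, seen in the direct sum. -/
abbrev hom (A : BigradedModule.{u} R) (p : ℤ × ℤ) (x : A.obj p) : A.Total :=
  DirectSum.lof R (ℤ × ℤ) A.obj p x

/-- The vertical shift `S A`, with `(S A)_i^j = A_i^{j-1}`.  The shift map `S : A → S A` of bidegree
`(0, 1)` is the identity on elements. -/
@[reducible] def shift (A : BigradedModule.{u} R) : BigradedModule.{u} R where
  obj p := A.obj (p.1, p.2 - 1)

end BigradedModule

/-- A (nonsymmetric) operad in bigraded `R`-modules, given by its insertion maps
`x ∘_{i+1} y`, here `circ i x y` with `i : Fin n` counted from `0`.  The insertion of an element of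
arity `m` into one of arity `n` has arity `k = n + m - 1`, and it has bidegree `(0, 0)`.  Arities and
bidegrees of composites are carried along as equations. -/
structure BigradedOperad (R : Type v) [CommRing R] where
  obj : ℕ → ℤ × ℤ → Type u
  [addCommGroup : ∀ n p, AddCommGroup (obj n p)]
  [module : ∀ n p, Module R (obj n p)]
  one : obj 1 (0, 0)
  circ : ∀ {n m k : ℕ} (_ : k + 1 = n + m) (_ : Fin n) {p q s : ℤ × ℤ} (_ : s = p + q),
    obj n p →ₗ[R] obj m q →ₗ[R] obj k s
  one_circ : ∀ {n : ℕ} {p : ℤ × ℤ} (hk : n + 1 = 1 + n) (hs : p = (0, 0) + p) (x : obj n p),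
    circ hk 0 hs one x = x
  circ_one : ∀ {n : ℕ} {p : ℤ × ℤ} (hk : n + 1 = n + 1) (i : Fin n) (hs : p = p + (0, 0))
    (x : obj n p), circ hk i hs x one = x
  /-- sequential composition: `(x ∘_i y) ∘_{i+j} z = x ∘_i (y ∘_j z)` -/
  circ_seq : ∀ {l m n a b c : ℕ} {p q r s t w : ℤ × ℤ}
    (h₁ : a + 1 = l + m) (h₂ : c + 1 = a + n) (h₃ : b + 1 = m + n) (h₄ : c + 1 = l + b)
    (g₁ : s = p + q) (g₂ : w = s + r) (g₃ : t = q + r) (g₄ : w = p + t)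
    (i : Fin l) (j : Fin m) (x : obj l p) (y : obj m q) (z : obj n r),
    circ h₂ ⟨i + j, by omega⟩ g₂ (circ h₁ i g₁ x y) z = circ h₄ i g₄ x (circ h₃ j g₃ y z)
  /-- parallel composition: `(x ∘_i y) ∘_{j+m-1} z = (-1)^⟨y,z⟩ (x ∘_j z) ∘_i y` for `i < j` -/
  circ_par : ∀ {l m n a b c : ℕ} {p q r s t w : ℤ × ℤ}
    (h₁ : a + 1 = l + m) (h₂ : c + 1 = a + n) (h₃ : b + 1 = l + n) (h₄ : c + 1 = b + m)
    (g₁ : s = p + q) (g₂ : w = s + r) (g₃ : t = p + r) (g₄ : w = t + q)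
    (i j : Fin l) (hij : (i : ℕ) < j) (x : obj l p) (y : obj m q) (z : obj n r),
    circ h₂ ⟨j + m - 1, by omega⟩ g₂ (circ h₁ i g₁ x y) z =
      (pairing q r).negOnePow • circ h₄ ⟨i, by omega⟩ g₄ (circ h₃ j g₃ x z) y

attribute [instance] BigradedOperad.addCommGroup BigradedOperad.module

/-- A morphism of bigraded operads. -/
structure OperadHom {R : Type v} [CommRing R] (P : BigradedOperad.{u} R)
    (Q : BigradedOperad.{w} R) where
  map : ∀ {n : ℕ} {p : ℤ × ℤ}, P.obj n p →ₗ[R] Q.obj n p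
  map_one : map P.one = Q.one
  map_circ : ∀ {n m k : ℕ} (hk : k + 1 = n + m) (i : Fin n) {p q s : ℤ × ℤ} (hs : s = p + q)
    (x : P.obj n p) (y : P.obj m q), map (P.circ hk i hs x y) = Q.circ hk i hs (map x) (map y)

/-! ### The operad of derived `A_∞`-algebras, by generators and relations -/

namespace DAInfty

variable (R : Type v) [CommRing R]

/-- Formal expressions in the operations of a bigraded operad and the generators `m_{ij}`, for `i ≥ 0`
and `j ≥ 1`, of arity `j` and bidegree `(i, 2 - (i + j))`. -/
inductive Expr : ℕ → ℤ × ℤ → Type v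
  | gen (i j : ℕ) (hj : 1 ≤ j) {p : ℤ × ℤ} (hp : p = ((i : ℤ), 2 - ((i : ℤ) + j))) : Expr j p
  | zero {n : ℕ} {p : ℤ × ℤ} : Expr n p
  | add {n : ℕ} {p : ℤ × ℤ} (x y : Expr n p) : Expr n p
  | smul {n : ℕ} {p : ℤ × ℤ} (c : R) (x : Expr n p) : Expr n p
  | one : Expr 1 (0, 0)
  | circ {n m k : ℕ} (hk : k + 1 = n + m) (i : Fin n) {p q s : ℤ × ℤ} (hs : s = p + q)
      (x : Expr n p) (y : Expr m q) : Expr k s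

variable {R}

/-- The sum of a list of expressions. -/
def Expr.listSum {n : ℕ} {p : ℤ × ℤ} (L : List (Expr R n p)) : Expr R n p :=
  L.foldr Expr.add Expr.zero

variable (R) in
/-- The left-hand side of the derived `A_∞`-relation for `a ≥ 0` and `b ≥ 1`:
the sum of `(-1)^{rq + t + pj} m_{ij}(1^r, m_{pq}, 1^t)` over all `i + p = a`, `r + q + t = b` with
`q ≥ 1`, where `j = r + 1 + t`.  Below `p = a - i`, `q = q' + 1` and `t = b - r - q`. -/
def relator (a b : ℕ) : Expr R b ((a : ℤ), 3 - ((a : ℤ) + b)) :=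
  Expr.listSum <|
    (List.finRange (a + 1)).flatMap fun (i : Fin (a + 1)) => (List.finRange b).flatMap fun (r : Fin b) =>
      (List.finRange (b - r)).map fun (q' : Fin (b - r)) =>
        Expr.smul
          ((-1 : R) ^ ((r : ℕ) * (q' + 1) + (b - r - (q' + 1)) + (a - i) * (r + 1 + (b - r - (q' + 1)))))
          (Expr.circ (by have := r.2; have := q'.2; omega) ⟨r, by omega⟩
            (by have := i.2; have := r.2; have := q'.2; ext <;> simp <;> omega)
            (Expr.gen (i : ℕ) (r + 1 + (b - r - (q' + 1))) (by omega) rfl)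
            (Expr.gen (a - i) (q' + 1) (by omega) rfl))

/-- The congruence generated by the axioms of a bigraded operad and the derived
`A_∞`-relations. -/
inductive Rel : ∀ {n : ℕ} {p : ℤ × ℤ}, Expr R n p → Expr R n p → Prop
  | relation (a b : ℕ) (hb : 1 ≤ b) : Rel (relator R a b) Expr.zero
  -- equivalence relation
  | refl {n p} (x : Expr R n p) : Rel x x
  | symm {n p} {x y : Expr R n p} : Rel x y → Rel y x
  | trans {n p} {x y z : Expr R n p} : Rel x y → Rel y z → Rel x z
  -- compatibility with the operations
  | add_congr {n p} {x x' y y' : Expr R n p} : Rel x x' → Rel y y' → Rel (x.add y) (x'.add y')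
  | smul_congr {n p} (c : R) {x x' : Expr R n p} : Rel x x' → Rel (x.smul c) (x'.smul c)
  | circ_congr {n m k} (hk : k + 1 = n + m) (i : Fin n) {p q s} (hs : s = p + q)
      {x x' : Expr R n p} {y y' : Expr R m q} : Rel x x' → Rel y y' →
      Rel (Expr.circ hk i hs x y) (Expr.circ hk i hs x' y')
  -- module axioms
  | add_assoc {n p} (x y z : Expr R n p) : Rel ((x.add y).add z) (x.add (y.add z))
  | add_comm {n p} (x y : Expr R n p) : Rel (x.add y) (y.add x)
  | zero_add {n p} (x : Expr R n p) : Rel (Expr.zero.add x) x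
  | neg_add {n p} (x : Expr R n p) : Rel ((x.smul (-1)).add x) Expr.zero
  | smul_add {n p} (c : R) (x y : Expr R n p) :
      Rel ((x.add y).smul c) ((x.smul c).add (y.smul c))
  | add_smul {n p} (c d : R) (x : Expr R n p) : Rel (x.smul (c + d)) ((x.smul c).add (x.smul d))
  | mul_smul {n p} (c d : R) (x : Expr R n p) : Rel (x.smul (c * d)) ((x.smul d).smul c)
  | one_smul {n p} (x : Expr R n p) : Rel (x.smul 1) x
  -- bilinearity of insertions
  | circ_add_left {n m k} (hk : k + 1 = n + m) (i : Fin n) {p q s} (hs : s = p + q)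
      (x x' : Expr R n p) (y : Expr R m q) : Rel (Expr.circ hk i hs (x.add x') y)
        ((Expr.circ hk i hs x y).add (Expr.circ hk i hs x' y))
  | circ_add_right {n m k} (hk : k + 1 = n + m) (i : Fin n) {p q s} (hs : s = p + q)
      (x : Expr R n p) (y y' : Expr R m q) : Rel (Expr.circ hk i hs x (y.add y'))
        ((Expr.circ hk i hs x y).add (Expr.circ hk i hs x y'))
  | circ_smul_left {n m k} (hk : k + 1 = n + m) (i : Fin n) {p q s} (hs : s = p + q) (c : R)
      (x : Expr R n p) (y : Expr R m q) :
      Rel (Expr.circ hk i hs (x.smul c) y) ((Expr.circ hk i hs x y).smul c)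
  | circ_smul_right {n m k} (hk : k + 1 = n + m) (i : Fin n) {p q s} (hs : s = p + q) (c : R)
      (x : Expr R n p) (y : Expr R m q) :
      Rel (Expr.circ hk i hs x (y.smul c)) ((Expr.circ hk i hs x y).smul c)
  -- operad axioms
  | one_circ {n p} (hk : n + 1 = 1 + n) (hs : p = (0, 0) + p) (x : Expr R n p) :
      Rel (Expr.circ hk 0 hs Expr.one x) x
  | circ_one {n p} (hk : n + 1 = n + 1) (i : Fin n) (hs : p = p + (0, 0)) (x : Expr R n p) :
      Rel (Expr.circ hk i hs x Expr.one) x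
  | circ_seq {l m n a b c : ℕ} {p q r s t w : ℤ × ℤ}
      (h₁ : a + 1 = l + m) (h₂ : c + 1 = a + n) (h₃ : b + 1 = m + n) (h₄ : c + 1 = l + b)
      (g₁ : s = p + q) (g₂ : w = s + r) (g₃ : t = q + r) (g₄ : w = p + t)
      (i : Fin l) (j : Fin m) (x : Expr R l p) (y : Expr R m q) (z : Expr R n r) :
      Rel (Expr.circ h₂ ⟨i + j, by omega⟩ g₂ (Expr.circ h₁ i g₁ x y) z)
        (Expr.circ h₄ i g₄ x (Expr.circ h₃ j g₃ y z))
  | circ_par {l m n a b c : ℕ} {p q r s t w : ℤ × ℤ}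
      (h₁ : a + 1 = l + m) (h₂ : c + 1 = a + n) (h₃ : b + 1 = l + n) (h₄ : c + 1 = b + m)
      (g₁ : s = p + q) (g₂ : w = s + r) (g₃ : t = p + r) (g₄ : w = t + q)
      (i j : Fin l) (hij : (i : ℕ) < j) (x : Expr R l p) (y : Expr R m q) (z : Expr R n r) :
      Rel (Expr.circ h₂ ⟨j + m - 1, by omega⟩ g₂ (Expr.circ h₁ i g₁ x y) z)
        ((Expr.circ h₄ ⟨i, by omega⟩ g₄ (Expr.circ h₃ j g₃ x z) y).smul
          (((pairing q r).negOnePow : ℤ) : R))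

variable (R) in
/-- Expressions up to the congruence. -/
def Obj (n : ℕ) (p : ℤ × ℤ) : Type v := Quot (Rel (R := R) (n := n) (p := p))

variable {n : ℕ} {p : ℤ × ℤ}

/-- The class of an expression. -/
def mk (x : Expr R n p) : Obj R n p := Quot.mk _ x

instance : Zero (Obj R n p) := ⟨mk Expr.zero⟩

instance : Add (Obj R n p) :=
  ⟨Quot.map₂ Expr.add (fun x _ _ h => Rel.add_congr (Rel.refl x) h)
    (fun _ _ y h => Rel.add_congr h (Rel.refl y))⟩

instance : SMul R (Obj R n p) := ⟨fun c => Quot.map (Expr.smul c) fun _ _ h => Rel.smul_congr c h⟩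

instance : Neg (Obj R n p) := ⟨fun x => (-1 : R) • x⟩

instance : AddCommGroup (Obj R n p) :=
  { AddGroup.ofLeftAxioms (G := Obj R n p)
      (by rintro ⟨x⟩ ⟨y⟩ ⟨z⟩; exact Quot.sound (Rel.add_assoc x y z))
      (by rintro ⟨x⟩; exact Quot.sound (Rel.zero_add x))
      (by rintro ⟨x⟩; exact Quot.sound (Rel.neg_add x)) with
    add_comm := by rintro ⟨x⟩ ⟨y⟩; exact Quot.sound (Rel.add_comm x y) }

instance : Module R (Obj R n p) :=
  Module.ofMinimalAxioms
    (by rintro c ⟨x⟩ ⟨y⟩; exact Quot.sound (Rel.smul_add c x y))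
    (by rintro c d ⟨x⟩; exact Quot.sound (Rel.add_smul c d x))
    (by rintro c d ⟨x⟩; exact Quot.sound (Rel.mul_smul c d x))
    (by rintro ⟨x⟩; exact Quot.sound (Rel.one_smul x))

/-- The insertion maps on classes of expressions. -/
def circ {n m k : ℕ} (hk : k + 1 = n + m) (i : Fin n) {p q s : ℤ × ℤ} (hs : s = p + q) :
    Obj R n p →ₗ[R] Obj R m q →ₗ[R] Obj R k s :=
  LinearMap.mk₂ R
    (Quot.map₂ (Expr.circ hk i hs) (fun x _ _ h => Rel.circ_congr hk i hs (Rel.refl x) h)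
      (fun _ _ y h => Rel.circ_congr hk i hs h (Rel.refl y)))
    (by rintro ⟨x⟩ ⟨x'⟩ ⟨y⟩; exact Quot.sound (Rel.circ_add_left hk i hs x x' y))
    (by rintro c ⟨x⟩ ⟨y⟩; exact Quot.sound (Rel.circ_smul_left hk i hs c x y))
    (by rintro ⟨x⟩ ⟨y⟩ ⟨y'⟩; exact Quot.sound (Rel.circ_add_right hk i hs x y y'))
    (by rintro c ⟨x⟩ ⟨y⟩; exact Quot.sound (Rel.circ_smul_right hk i hs c x y))

end DAInfty

open DAInfty in
/-- The operad `dA_∞` of derived `A_∞`-algebras in bigraded `R`-modules: it is generated by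
`{m_{ij}}_{i ≥ 0, j ≥ 1}` subject to the derived `A_∞`-relations. -/
def dAInfty (R : Type v) [CommRing R] : BigradedOperad.{v} R where
  obj := Obj R
  one := mk Expr.one
  circ := circ
  one_circ := by rintro n p hk hs ⟨x⟩; exact Quot.sound (Rel.one_circ hk hs x)
  circ_one := by rintro n p hk i hs ⟨x⟩; exact Quot.sound (Rel.circ_one hk i hs x)
  circ_seq := by
    rintro l m n a b c p q r s t w h₁ h₂ h₃ h₄ g₁ g₂ g₃ g₄ i j ⟨x⟩ ⟨y⟩ ⟨z⟩
    exact Quot.sound (Rel.circ_seq h₁ h₂ h₃ h₄ g₁ g₂ g₃ g₄ i j x y z)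
  circ_par := by
    rintro l m n a b c p q r s t w h₁ h₂ h₃ h₄ g₁ g₂ g₃ g₄ i j hij ⟨x⟩ ⟨y⟩ ⟨z⟩
    rw [Units.smul_def, ← Int.cast_smul_eq_zsmul R]
    exact Quot.sound (Rel.circ_par h₁ h₂ h₃ h₄ g₁ g₂ g₃ g₄ i j hij x y z)

/-- The generator `m_{ij}` of `dA_∞`. -/
def dAInfty.gen (R : Type v) [CommRing R] (i j : ℕ) (hj : 1 ≤ j) {p : ℤ × ℤ}
    (hp : p = ((i : ℤ), 2 - ((i : ℤ) + j))) : (dAInfty R).obj j p :=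
  DAInfty.mk (DAInfty.Expr.gen i j hj hp)

/-! ### Derived `A_∞`-algebras -/

/-- A derived `A_∞`-algebra structure on a bigraded module `A`: `R`-linear maps
`m_{ij} : A^{⊗j} → A` of bidegree `(i, 2 - (i + j))`, for `i ≥ 0` and `j ≥ 1`, satisfying the derived
`A_∞`-equation.  They are written as `R`-multilinear maps on the direct sum of the components of
`A`; the unused maps with `j = 0` are `0` by convention. -/
@[ext]
structure DerivedAInftyAlgebra {R : Type v} [CommRing R] (A : BigradedModule.{u} R) where
  map : ∀ _ j : ℕ, MultilinearMap R (fun _ : Fin j => A.Total) A.Total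
  map_arity_zero : ∀ i, map i 0 = 0
  /-- `m_{ij}` has bidegree `(i, 2 - (i + j))`. -/
  bidegree : ∀ (i j : ℕ) (p : Fin j → ℤ × ℤ) (x : ∀ a, A.obj (p a)),
    ∃ y : A.obj (∑ a, p a + ((i : ℤ), 2 - ((i : ℤ) + j))),
      map i j (fun a => A.hom (p a) (x a)) = A.hom _ y
  /-- The derived `A_∞`-equation
  `∑ (-1)^{rq + t + pj} m_{ij}(1^{⊗r} ⊗ m_{pq} ⊗ 1^{⊗t}) = 0`, summed over `i + p = b` and
  `r + q + t = c` with `q ≥ 1` and `j = r + 1 + t`, and evaluated at homogeneous elements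
  `x_1, …, x_c` of bidegrees `d_1, …, d_c`.  These are the first `c` terms of the sequences `x`
  and `d` (counted from `0`); the other terms do not occur.  By the Koszul rule the inner map
  contributes the sign `(-1)^⟨m_{pq}, x_1 ⊗ ⋯ ⊗ x_r⟩`. -/
  relation : ∀ b c : ℕ, 1 ≤ c → ∀ (d : ℕ → ℤ × ℤ) (x : ∀ a, A.obj (d a)),
    ∑ ip ∈ Finset.HasAntidiagonal.antidiagonal b,
      ∑ rqt ∈ (Finset.Nat.antidiagonalTuple 3 c).filter (fun rqt => 1 ≤ rqt 1),
        ((-1 : R) ^ (rqt 0 * rqt 1 + rqt 2 + ip.2 * (rqt 0 + 1 + rqt 2))) •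
          (pairing ((ip.2 : ℤ), 2 - ((ip.2 : ℤ) + rqt 1))
              (∑ a ∈ Finset.range (rqt 0), d a)).negOnePow •
            map ip.1 (rqt 0 + 1 + rqt 2) (fun a =>
              if (a : ℕ) < rqt 0 then A.hom (d a) (x a)
              else if (a : ℕ) = rqt 0 then
                map ip.2 (rqt 1) (fun e => A.hom (d (rqt 0 + e)) (x (rqt 0 + e)))
              else A.hom (d (a - 1 + rqt 1)) (x (a - 1 + rqt 1))) = 0

/-! ### Operadic suspension and braces -/

namespace BigradedOperad

variable {R : Type v} [CommRing R]

/-- Transport along equalities of arities and bidegrees. -/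
def cast (P : BigradedOperad.{u} R) {n k : ℕ} {p q : ℤ × ℤ} (hn : n = k) (hp : p = q)
    (x : P.obj n p) : P.obj k q := hn ▸ hp ▸ x

theorem circ_cast_left (P : BigradedOperad.{u} R) {n m k : ℕ} (hk : k + 1 = n + m) (i : Fin n)
    {p p' q s : ℤ × ℤ} (hp : p = p') (hs : s = p' + q) (x : P.obj n p) (y : P.obj m q) :
    P.circ hk i hs (P.cast rfl hp x) y = P.circ hk i (hp ▸ hs) x y := by
  subst hp; rfl

theorem circ_cast_right (P : BigradedOperad.{u} R) {n m k : ℕ} (hk : k + 1 = n + m) (i : Fin n)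
    {p q q' s : ℤ × ℤ} (hq : q = q') (hs : s = p + q') (x : P.obj n p) (y : P.obj m q) :
    P.circ hk i hs x (P.cast rfl hq y) = P.circ hk i (hq ▸ hs) x y := by
  subst hq; rfl

/-- `O` is horizontally bounded on the right: every `O(n)` vanishes in all large horizontal
degrees. -/
def HorizontallyBounded (O : BigradedOperad.{u} R) : Prop :=
  ∀ n : ℕ, ∃ N : ℤ, ∀ p : ℤ × ℤ, N < p.1 → Subsingleton (O.obj n p)

/-- A derived `A_∞`-multiplication on `O` is a map of operads `dA_∞ → O`. -/
abbrev DerivedAInftyMultiplication (O : BigradedOperad.{u} R) := OperadHom (dAInfty R) O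

/-- The vertical operadic suspension `𝔰O`, with `𝔰O(n) = O(n) ⊗ Λ(n)` and `Λ(n)` free of rank one on
a generator `e^n` of bidegree `(0, n - 1)`.  An element `x ⊗ e^n` is written as `x`, and so an
element of `𝔰O(n)` of (natural) bidegree `(k, d)` is an element of `O(n)` of (internal) bidegree
`(k, d - n + 1)`.  The insertion into position `i + 1` gets the sign `(-1)^{(n-1) deg y}` for moving
`e^n` past `y`, where `deg y` is the internal vertical degree of `y`, and the sign
`(-1)^{(n-(i+1))(m-1)}` from `e^n ∘_{i+1} e^m = (-1)^{(n-(i+1))(m-1)} e^{n+m-1}`. -/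
@[reducible] def suspension (O : BigradedOperad.{u} R) : BigradedOperad.{u} R where
  obj n p := O.obj n (p.1, p.2 + 1 - n)
  one := O.cast rfl (by simp) O.one
  circ {n m k} hk i {p q s} hs :=
    (((n : ℤ) - 1) * (q.2 + 1 - m) + ((n : ℤ) - (i + 1)) * ((m : ℤ) - 1)).negOnePow •
      O.circ hk i (by subst hs; ext <;> simp <;> omega)
  one_circ := by
    intro n p hk hs x
    rw [LinearMap.smul_apply, LinearMap.smul_apply, circ_cast_left, O.one_circ]
    simp
  circ_one := by
    intro n p hk i hs x
    rw [LinearMap.smul_apply, LinearMap.smul_apply, circ_cast_right, O.circ_one]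
    simp
  circ_seq := by
    intro l m n a b c p q r s t w h₁ h₂ h₃ h₄ g₁ g₂ g₃ g₄ i j x y z
    simp only [LinearMap.smul_apply, Units.smul_def, map_zsmul, smul_smul, ← Units.val_mul,
      ← Int.negOnePow_add]
    have e₃ : ((t.1, t.2 + 1 - b) : ℤ × ℤ) = (q.1, q.2 + 1 - m) + (r.1, r.2 + 1 - n) := by
      subst g₃; ext <;> simp <;> omega
    have e₄ : ((w.1, w.2 + 1 - c) : ℤ × ℤ) = (p.1, p.2 + 1 - l) + (t.1, t.2 + 1 - b) := by
      subst g₄; ext <;> simp <;> omega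
    rw [O.circ_seq h₁ h₂ h₃ h₄ _ _ e₃ e₄ i j]
    congr 3
    have ha : (a : ℤ) = l + m - 1 := by omega
    have hb : (b : ℤ) = m + n - 1 := by omega
    subst g₃
    rw [ha, hb]
    push_cast
    simp only [Prod.snd_add]
    ring
  circ_par := by
    intro l m n a b c p q r s t w h₁ h₂ h₃ h₄ g₁ g₂ g₃ g₄ i j hij x y z
    simp only [LinearMap.smul_apply, Units.smul_def, map_zsmul, smul_smul, ← Units.val_mul,
      ← Int.negOnePow_add]
    have e₃ : ((t.1, t.2 + 1 - b) : ℤ × ℤ) = (p.1, p.2 + 1 - l) + (r.1, r.2 + 1 - n) := by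
      subst g₃; ext <;> simp <;> omega
    have e₄ : ((w.1, w.2 + 1 - c) : ℤ × ℤ) = (t.1, t.2 + 1 - b) + (q.1, q.2 + 1 - m) := by
      subst g₄; ext <;> simp <;> omega
    rw [O.circ_par h₁ h₂ h₃ h₄ _ _ e₃ e₄ i j hij]
    simp only [Units.smul_def, smul_smul, ← Units.val_mul, ← Int.negOnePow_add]
    congr 2
    rw [Int.negOnePow_eq_iff]
    refine ⟨-((n : ℤ) - 1) * q.2, ?_⟩
    have ha : (a : ℤ) = l + m - 1 := by omega
    have hb : (b : ℤ) = l + n - 1 := by omega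
    have hj : ((j + m - 1 : ℕ) : ℤ) = j + m - 1 := by omega
    simp only [pairing, ha, hb, hj]
    ring

/-- The underlying bigraded module `∏_n P(n)` of an operad. -/
@[reducible] def underlying (P : BigradedOperad.{u} R) : BigradedModule.{u} R where
  obj p := ∀ n, P.obj n p

/-- The sum of all `γ(x; 1, …, 1, y_1, 1, …, 1, y_j, 1, …, 1)` over all order-preserving insertions of
`y_1, …, y_j` into `x` that use no input of `x` before the `s`-th one.  It is computed by first
inserting `y_1` into the input `i`, and then the others into inputs after the ones of `y_1`. -/
def braceFrom (P : BigradedOperad.{u} R) : (j : ℕ) → {N : ℕ} → {p₀ : ℤ × ℤ} → P.obj N p₀ → (s : ℕ) →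
    (a : Fin j → ℕ) → (p : Fin j → ℤ × ℤ) → (∀ v, P.obj (a v) (p v)) →
    (k : ℕ) → k + j = N + ∑ v, a v → (q : ℤ × ℤ) → q = p₀ + ∑ v, p v → P.obj k q
  | 0, _, _, x, _, _, _, _, _, hk, _, hq => P.cast (by simpa using hk.symm) (by simpa using hq.symm) x
  | j + 1, N, p₀, x, s, a, p, y, k, hk, q, hq =>
    ∑ i : Fin N,
      if s ≤ i then
        P.braceFrom j (P.circ (k := N + a 0 - 1) (by have := i.2; omega) i (s := p₀ + p 0) rfl x (y 0)) (i + a 0)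
          (fun v => a v.succ) (fun v => p v.succ) (fun v => y v.succ)
          k (by have := i.2; rw [Fin.sum_univ_succ] at hk; omega) q (by rw [hq, Fin.sum_univ_succ, add_assoc])
      else 0

/-- The brace `b_j(x; y_1, …, y_j)` on the underlying bigraded module of an operad.  On
`x ∈ P(N)` and `y_v ∈ P(a_v)` it is the sum of all
`γ(x; 1, …, 1, y_1, 1, …, 1, y_j, 1, …, 1)`, which has arity `N - j + ∑ a_v`.  An element of
`∏_n P(n)` is the sum of its components; the component of the brace in arity `k` is the sum over the
finitely many `N, a_1, …, a_j` with `N + ∑ a_v = k + j`. -/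
def brace (P : BigradedOperad.{u} R) {j : ℕ} {p₀ : ℤ × ℤ} (x : P.underlying.obj p₀)
    (p : Fin j → ℤ × ℤ) (y : ∀ v, P.underlying.obj (p v)) (q : ℤ × ℤ) (hq : q = p₀ + ∑ v, p v) :
    P.underlying.obj q :=
  fun k => ∑ c ∈ (Finset.Nat.antidiagonalTuple (j + 1) (k + j)).attach,
    P.braceFrom j (x (c.1 0)) 0 (fun v => c.1 v.succ) p (fun v => y v (c.1 v.succ)) k
      (by
        have h := Finset.Nat.mem_antidiagonalTuple.1 c.2
        rw [Fin.sum_univ_succ] at h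
        exact h.symm) q hq

variable (O : BigradedOperad.{u} R)

/-- The element `∑_l m_{il}` of `𝔰O`, which has bidegree `(i, 1 - i)`: its component in arity `l ≥ 1`
is the image of the generator `m_{il}`, and its component in arity `0` is zero. -/
def multiplication (m : O.DerivedAInftyMultiplication) (i : ℕ) :
    O.suspension.underlying.obj ((i : ℤ), 1 - (i : ℤ)) :=
  fun l => if hl : 1 ≤ l then m.map (dAInfty.gen R i l hl (by ext; exacts [rfl, by simp; omega])) else 0

/-- `A = S𝔰O`. -/
abbrev shiftedSuspension : BigradedModule.{u} R := O.suspension.underlying.shift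

/-- `M_{ij}(x_1, …, x_j) = (-1)^{∑_v (j - v) (d_v - k_v)} ∑_l S b_j(m_{il}; y_1, …, y_j)` for
homogeneous `x_v = S y_v`.  If `x_v` has bidegree `p_v` in `S𝔰O`, then `y_v = S⁻¹ x_v` has bidegree
`(k_v, d_v - k_v) = (p_v.1, p_v.2 - 1)` in `𝔰O`. -/
def higherMap (m : O.DerivedAInftyMultiplication) (i : ℕ) {j : ℕ} (p : Fin j → ℤ × ℤ)
    (x : ∀ v, O.shiftedSuspension.obj (p v)) :
    O.shiftedSuspension.obj (∑ v, p v + ((i : ℤ), 2 - ((i : ℤ) + j))) :=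
  (∑ v : Fin j, ((j : ℤ) - (v + 1)) * ((p v).2 - 1)).negOnePow •
    O.suspension.brace (O.multiplication m i) (fun v => ((p v).1, (p v).2 - 1)) x _
      (by ext <;> simp [Prod.fst_sum, Prod.snd_sum] <;> ring)

/-- `M_{i1}(x) = ∑_l (S b_1(m_{il}; S⁻¹x) - (-1)^⟨x, m_{il}⟩ S b_1(S⁻¹x; m_{il}))`, where the pairing is
the one of the bidegrees of `S⁻¹x` and `m_{il}` in `𝔰O`: for `x` of bidegree `(k, d - k)` it is
`i k + (1 - i) (d - 1 - k)`. -/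
def arityOneMap (m : O.DerivedAInftyMultiplication) (i : ℕ) (p : ℤ × ℤ)
    (x : O.shiftedSuspension.obj p) :
    O.shiftedSuspension.obj (p + ((i : ℤ), 2 - ((i : ℤ) + 1))) :=
  O.suspension.brace (O.multiplication m i) (fun _ : Fin 1 => (p.1, p.2 - 1)) (fun _ => x) _
      (by ext <;> simp [Prod.fst_sum, Prod.snd_sum] <;> ring) -
    (pairing (p.1, p.2 - 1) ((i : ℤ), 1 - (i : ℤ))).negOnePow •
      O.suspension.brace (p₀ := (p.1, p.2 - 1)) x (fun _ : Fin 1 => ((i : ℤ), 1 - (i : ℤ)))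
        (fun _ => O.multiplication m i) _ (by ext <;> simp [Prod.fst_sum, Prod.snd_sum] <;> ring)

end BigradedOperad

end DerivedOperad

/-!
The argument takes place in the suspension `P = 𝔰O`.  Write `m_i = ∑_l m_{il}`, an element of
bidegree `(i, 1 - i)` of `∏_n P(n)`.  The signs of the insertions in `𝔰O` turn the relations between the
generators `m_{ij}` into `∑_{i + p = u} (-1)^p m_i{m_p} = 0` for all `u`
(`sum_brace_truncatedMultiplication_eq_zero`).

Braces satisfy two composition identities, which follow from the sequential and the parallel
associativity of insertions by induction on the number of inserted elements:

* `(x{w}){L}` is the sum of all `± x{L₁, w{L₂}, L₃}` with `L = L₁ L₂ L₃` (`brace_brace_singleton`),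
* `(x{L}){w}` is the sum of all `± x{L₁, w, L₂}` with `L = L₁ L₂` and of all `± x{L₁, y{w}, L₂}` with
  `L = L₁ y L₂` (`brace_singleton_brace`).

Put `M_i(L) = m_i{L}`, with the additional summand `∓ y{m_i}` if `L = (y)`.  In the sum of all
`± M_i(L₁, M_p(L₂), L₃)` with nonempty `L₂`, the terms `m_i{L₁, m_p{L₂}, L₃}` are all those of
`(m_i{m_p}){L}` except the `m_i{L₁, m_p, L₂}`.  The additional summands contribute
`∓ (m_p{L}){m_i}`, which by the second identity supplies the missing terms, after exchanging `i` and
`p`, and cancels the terms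
`m_i{L₁, y{m_p}, L₂}` which stem from the `M_p(y)`.  For `L = (y)` the terms `(y{m_p}){m_i}` remain; they
add up to `y{∑ ± m_p{m_i}} = 0`, as the terms `y{m_p, m_i}` cancel in pairs
(`sum_operation_operation_eq_zero`).  The signs in the definition of `M_{ij}` on `S𝔰O` are those
by which the shift `S` translates this identity into the derived `A_∞`-equation
(`sum_shift_exponents`).

Two devices keep the computations elementary.  Braces are computed in the direct sum of all
the modules `P(n)_i^j`, where arities and bidegrees do not occur in types (`InsertionSystem`).  And as
the component of a brace in a given arity depends only on finitely many components of its
arguments (`brace_apply_congr`), elements of the product `∏_n P(n)` may be replaced by finitely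
supported families (`incl_brace`).
-/

namespace DerivedOperad

/-! ### Braces in a graded group with insertions -/

/-- An operad written inside one abelian group `T`: the subgroup `homogeneous n p` holds the elements
of arity `n` and bidegree `p`, and `circ i` is the insertion into the input `i`, counted from `0`.
Only the properties which the brace identities use are recorded. -/
structure InsertionSystem (T : Type u) [AddCommGroup T] where
  homogeneous : ℕ → ℤ × ℤ → AddSubgroup T
  circ : ℕ → T →+ T →+ T
  circ_mem : ∀ {n m i : ℕ} {p q : ℤ × ℤ} {x y : T}, i < n → x ∈ homogeneous n p →
    y ∈ homogeneous m q → circ i x y ∈ homogeneous (n + m - 1) (p + q)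
  circ_seq : ∀ {l m n i j : ℕ} {p q r : ℤ × ℤ} {x y z : T}, i < l → j < m →
    x ∈ homogeneous l p → y ∈ homogeneous m q → z ∈ homogeneous n r →
    circ (i + j) (circ i x y) z = circ i x (circ j y z)
  circ_par : ∀ {l m n i j : ℕ} {p q r : ℤ × ℤ} {x y z : T}, i < j → j < l →
    x ∈ homogeneous l p → y ∈ homogeneous m q → z ∈ homogeneous n r →
    circ (j + m - 1) (circ i x y) z = (pairing q r).negOnePow • circ i (circ j x z) y

theorem pairing_comm (p q : ℤ × ℤ) : pairing p q = pairing q p := by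
  simp only [pairing]; ring

theorem pairing_add_right (p q r : ℤ × ℤ) : pairing p (q + r) = pairing p q + pairing p r := by
  simp only [pairing, Prod.fst_add, Prod.snd_add]; ring

theorem pairing_add_left (p q r : ℤ × ℤ) : pairing (p + q) r = pairing p r + pairing q r := by
  simp only [pairing, Prod.fst_add, Prod.snd_add]; ring

theorem pairing_zero_right (p : ℤ × ℤ) : pairing p 0 = 0 := by
  simp [pairing]

namespace InsertionSystem

open Finset

variable {T : Type u} [AddCommGroup T]

/-- A finitely supported family of elements of all arities, together with a bidegree. -/
abbrev Family (T : Type u) [AddCommGroup T] := (ℤ × ℤ) × (ℕ →₀ T)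

/-- The total bidegree of a list of families. -/
def totalDegree (L : List (Family T)) : ℤ × ℤ := (L.map Prod.fst).sum

@[simp] theorem totalDegree_nil : totalDegree ([] : List (Family T)) = 0 := rfl

@[simp] theorem totalDegree_cons (y : Family T) (L : List (Family T)) :
    totalDegree (y :: L) = y.1 + totalDegree L := by simp [totalDegree]

theorem totalDegree_append (L L' : List (Family T)) :
    totalDegree (L ++ L') = totalDegree L + totalDegree L' := by simp [totalDegree]

variable (S : InsertionSystem T)

/-- The components of a family are homogeneous of the bidegree of the family. -/
def IsHomogeneous (y : Family T) : Prop := ∀ a, y.2 a ∈ S.homogeneous a y.1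

/-- `S.insertFrom L N s x` is the sum of all ways to insert the members of the list `L`, in their
order, into an element `x` of arity `N`, leaving the first `s` inputs of `x` free. -/
noncomputable def insertFrom : List (Family T) → ℕ → ℕ → T →+ (ℕ →₀ T)
  | [], N, _ => Finsupp.singleAddHom N
  | y :: L, N, s => ∑ a ∈ y.2.support, ∑ i ∈ Ico s N,
      (insertFrom L (N + a - 1) (i + a)).comp ((S.circ i).flip (y.2 a))

@[simp] theorem insertFrom_nil (N s : ℕ) (x : T) : S.insertFrom [] N s x = Finsupp.single N x := rfl

theorem insertFrom_cons (y : Family T) (L : List (Family T)) (N s : ℕ) (x : T) :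
    S.insertFrom (y :: L) N s x = ∑ a ∈ y.2.support, ∑ i ∈ Ico s N,
      S.insertFrom L (N + a - 1) (i + a) (S.circ i x (y.2 a)) := by
  simp [insertFrom]

/-- The brace `x{L_1, …, L_j}` of finitely supported families. -/
noncomputable def brace (L : List (Family T)) : (ℕ →₀ T) →+ (ℕ →₀ T) :=
  Finsupp.liftAddHom fun N => S.insertFrom L N 0

theorem brace_apply (L : List (Family T)) (x : ℕ →₀ T) :
    S.brace L x = ∑ N ∈ x.support, S.insertFrom L N 0 (x N) := rfl

theorem brace_single (L : List (Family T)) (N : ℕ) (x : T) :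
    S.brace L (Finsupp.single N x) = S.insertFrom L N 0 x :=
  Finsupp.liftAddHom_apply_single _ _ _

@[simp] theorem brace_nil (x : ℕ →₀ T) : S.brace [] x = x := by
  rw [brace, show (fun N => S.insertFrom [] N 0) = Finsupp.singleAddHom from rfl,
    Finsupp.liftAddHom_singleAddHom]
  rfl

/-- The family of a brace. -/
noncomputable def braceFamily (x : Family T) (L : List (Family T)) : Family T :=
  (x.1 + totalDegree L, S.brace L x.2)

theorem insertFrom_cons_liftAddHom (d : ℤ × ℤ) (y : ℕ →₀ T) (L : List (Family T)) (N s : ℕ) (x : T) :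
    S.insertFrom ((d, y) :: L) N s x = Finsupp.liftAddHom (fun a => ∑ i ∈ Ico s N,
      (S.insertFrom L (N + a - 1) (i + a)).comp (S.circ i x)) y := by
  rw [insertFrom_cons, Finsupp.liftAddHom_apply, Finsupp.sum]
  simp

/-- Insertions are additive in each of the inserted families, and ignore their bidegrees. -/
theorem exists_insertFrom_eq (L L' : List (Family T)) (N s : ℕ) (x : T) :
    ∃ φ : (ℕ →₀ T) →+ (ℕ →₀ T), ∀ y : Family T, S.insertFrom (L ++ y :: L') N s x = φ y.2 := by
  induction L generalizing N s x with
  | nil => exact ⟨_, fun y => S.insertFrom_cons_liftAddHom y.1 y.2 L' N s x⟩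
  | cons z L ih =>
    choose φ hφ using ih
    refine ⟨∑ a ∈ z.2.support, ∑ i ∈ Ico s N, φ (N + a - 1) (i + a) (S.circ i x (z.2 a)), fun y => ?_⟩
    rw [List.cons_append, insertFrom_cons]
    simp [hφ]

theorem exists_brace_eq (L L' : List (Family T)) (x : ℕ →₀ T) :
    ∃ φ : (ℕ →₀ T) →+ (ℕ →₀ T), ∀ y : Family T, S.brace (L ++ y :: L') x = φ y.2 := by
  choose φ hφ using fun N => S.exists_insertFrom_eq L L' N 0 (x N)
  refine ⟨∑ N ∈ x.support, φ N, fun y => ?_⟩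
  simp [brace_apply, hφ]

theorem zsmul_unit_map {A B : Type*} [AddCommGroup A] [AddCommGroup B] (f : A →+ B) (e : ℤˣ) (a : A) :
    f (e • a) = e • f a := by
  simp [Units.smul_def]

/-- Insertion of `w`, of arity `m`, into the input `i` of all the members of a family. -/
noncomputable def insertAt (i m : ℕ) (w : T) : (ℕ →₀ T) →+ (ℕ →₀ T) :=
  Finsupp.liftAddHom fun n => (Finsupp.singleAddHom (n + m - 1)).comp ((S.circ i).flip w)

theorem insertAt_single (i m : ℕ) (w : T) (n : ℕ) (x : T) :
    S.insertAt i m w (Finsupp.single n x) = Finsupp.single (n + m - 1) (S.circ i x w) := by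
  simp [insertAt]

variable {S}

/-- An insertion into an input before all the inputs used by `L` commutes with the insertion of `L`,
up to the Koszul sign. -/
theorem insertAt_insertFrom {L : List (Family T)} (hL : ∀ y ∈ L, S.IsHomogeneous y)
    {N s i m : ℕ} {p e : ℤ × ℤ} (hi : i < s) {x w : T} (hx : x ∈ S.homogeneous N p)
    (hw : w ∈ S.homogeneous m e) :
    S.insertAt i m w (S.insertFrom L N s x) =
      (pairing e (totalDegree L)).negOnePow •
        S.insertFrom L (N + m - 1) (s + m - 1) (S.circ i x w) := by
  induction L generalizing N s p x with
  | nil => simp [insertAt_single, pairing_zero_right]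
  | cons y L ih =>
    rw [insertFrom_cons, insertFrom_cons, map_sum, smul_sum]
    refine sum_congr rfl fun a _ => ?_
    rw [map_sum, smul_sum]
    have hy : S.IsHomogeneous y := hL y (by simp)
    refine sum_nbij' (fun i₀ => i₀ + m - 1) (fun i₀ => i₀ + 1 - m) ?_ ?_ ?_ ?_ ?_
    · intro i₀ h; simp only [mem_Ico] at h ⊢; omega
    · intro i₀ h; simp only [mem_Ico] at h ⊢; omega
    · intro i₀ h; simp only [mem_Ico] at h ⊢; omega
    · intro i₀ h; simp only [mem_Ico] at h ⊢; omega
    · intro i₀ h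
      rw [mem_Ico] at h
      rw [ih (fun z hz => hL z (by simp [hz])) (by omega) (S.circ_mem h.2 hx (hy a)),
        S.circ_par (by omega) h.2 hx hw (hy a), zsmul_unit_map, smul_smul, ← Int.negOnePow_add]
      have e₁ : N + a - 1 + m - 1 = N + m - 1 + a - 1 := by omega
      have e₂ : i₀ + a + m - 1 = i₀ + m - 1 + a := by omega
      rw [e₁, e₂, totalDegree_cons, pairing_add_right]
      congr 1
      rw [Int.negOnePow_eq_iff]
      exact ⟨-pairing e y.1, by ring⟩

/-- After insertions into inputs from `s` on, the first `s` inputs are still there. -/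
theorem insertFrom_apply_eq_zero_of_lt (L : List (Family T)) {N s n : ℕ} (hs : s ≤ N) (hn : n < s) (x : T) :
    S.insertFrom L N s x n = 0 := by
  induction L generalizing N s x with
  | nil => simp [Finsupp.single_apply]; omega
  | cons y L ih =>
    rw [insertFrom_cons, Finsupp.finsetSum_apply]
    refine sum_eq_zero fun a _ => ?_
    rw [Finsupp.finsetSum_apply]
    refine sum_eq_zero fun i hi => ?_
    rw [mem_Ico] at hi
    exact ih (by omega) (by omega) _

/-- Insertions into the inputs from `s` on are those into the inputs from `s'` on and those in
between. -/
theorem liftAddHom_insertFrom_split (w : Family T) (L : List (Family T)) {N s s' : ℕ} (hs : s ≤ s')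
    (hs' : s' ≤ N) (x : T) :
    Finsupp.liftAddHom (fun n => S.insertFrom [w] n s) (S.insertFrom L N s' x) =
      Finsupp.liftAddHom (fun n => S.insertFrom [w] n s') (S.insertFrom L N s' x) +
        ∑ m ∈ w.2.support, ∑ i ∈ Ico s s', S.insertAt i m (w.2 m) (S.insertFrom L N s' x) := by
  set z := S.insertFrom L N s' x with hz
  simp only [insertAt, Finsupp.liftAddHom_apply, Finsupp.sum, insertFrom_cons, insertFrom_nil]
  simp_rw [sum_comm (s := Ico s s')]
  rw [sum_comm (s := w.2.support), ← sum_add_distrib]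
  refine sum_congr rfl fun n hn => ?_
  have hn' : s' ≤ n := by
    by_contra h
    exact (Finsupp.mem_support_iff.1 hn)
      (by rw [hz]; exact insertFrom_apply_eq_zero_of_lt L hs' (by omega) x)
  rw [← sum_add_distrib]
  refine sum_congr rfl fun m _ => ?_
  rw [← sum_Ico_consecutive _ hs hn', add_comm]
  rfl

/-! ### Composition of braces -/

/-- Composition of a brace with one more family `w`, restricted to the inputs from `s` on: `w` goes
either into a free input or into one of the families that have been inserted. -/
theorem liftAddHom_insertFrom_insertFrom {w : Family T} (hw : S.IsHomogeneous w) {L : List (Family T)}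
    (hL : ∀ y ∈ L, S.IsHomogeneous y) {N s : ℕ} (hs : s ≤ N) {p : ℤ × ℤ} {x : T}
    (hx : x ∈ S.homogeneous N p) :
    Finsupp.liftAddHom (fun n => S.insertFrom [w] n s) (S.insertFrom L N s x) =
      ∑ r ∈ range (L.length + 1), (pairing w.1 (totalDegree (L.drop r))).negOnePow •
          S.insertFrom (L.take r ++ w :: L.drop r) N s x +
        ∑ r ∈ range L.length, (pairing w.1 (totalDegree (L.drop (r + 1)))).negOnePow •
          S.insertFrom (L.take r ++ S.braceFamily (L.getD r 0) [w] :: L.drop (r + 1)) N s x := by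
  induction L generalizing N s p x with
  | nil => simp [pairing_zero_right]
  | cons y L ih =>
    have hy : S.IsHomogeneous y := hL y (by simp)
    have hL' : ∀ z ∈ L, S.IsHomogeneous z := fun z hz => hL z (by simp [hz])
    -- the part of the sum in which `w` is inserted before `y`
    have before : ∑ a ∈ y.2.support, ∑ i₀ ∈ Ico s N, ∑ m ∈ w.2.support, ∑ i ∈ Ico s i₀,
        S.insertAt i m (w.2 m) (S.insertFrom L (N + a - 1) (i₀ + a) (S.circ i₀ x (y.2 a))) =
        (pairing w.1 (totalDegree (y :: L))).negOnePow • S.insertFrom (w :: y :: L) N s x := by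
      trans ∑ m ∈ w.2.support, ∑ a ∈ y.2.support, ∑ i ∈ Ico s N, ∑ i₀ ∈ Ico (i + 1) N,
        S.insertAt i m (w.2 m) (S.insertFrom L (N + a - 1) (i₀ + a) (S.circ i₀ x (y.2 a)))
      · rw [sum_comm (s := w.2.support)]
        refine sum_congr rfl fun a _ => ?_
        rw [sum_comm (t := w.2.support)]
        exact sum_congr rfl fun m _ => (sum_Ico_Ico_comm' _ _ _).symm
      rw [S.insertFrom_cons w, smul_sum]
      refine sum_congr rfl fun m _ => ?_
      rw [sum_comm, smul_sum]
      refine sum_congr rfl fun i hi => ?_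
      rw [mem_Ico] at hi
      rw [S.insertFrom_cons y, smul_sum]
      refine sum_congr rfl fun a _ => ?_
      rw [smul_sum]
      refine sum_nbij' (fun i₀ => i₀ + m - 1) (fun i₀ => i₀ + 1 - m) ?_ ?_ ?_ ?_ ?_
      · intro i₀ h; simp only [mem_Ico] at h ⊢; omega
      · intro i₀ h; simp only [mem_Ico] at h ⊢; omega
      · intro i₀ h; simp only [mem_Ico] at h ⊢; omega
      · intro i₀ h; simp only [mem_Ico] at h ⊢; omega
      · intro i₀ h
        rw [mem_Ico] at h
        rw [insertAt_insertFrom hL' (by omega) (S.circ_mem h.2 hx (hy a)) (hw m),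
          S.circ_par (by omega) h.2 hx (hw m) (hy a), zsmul_unit_map, smul_smul,
          ← Int.negOnePow_add]
        have e₁ : N + a - 1 + m - 1 = N + m - 1 + a - 1 := by omega
        have e₂ : i₀ + a + m - 1 = i₀ + m - 1 + a := by omega
        rw [e₁, e₂, totalDegree_cons, pairing_add_right]
        congr 1
        rw [Int.negOnePow_eq_iff]
        exact ⟨-pairing w.1 y.1, by ring⟩
    -- the part of the sum in which `w` is inserted into `y`
    have inside : ∑ a ∈ y.2.support, ∑ i₀ ∈ Ico s N, ∑ m ∈ w.2.support, ∑ i ∈ Ico i₀ (i₀ + a),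
        S.insertAt i m (w.2 m) (S.insertFrom L (N + a - 1) (i₀ + a) (S.circ i₀ x (y.2 a))) =
        (pairing w.1 (totalDegree L)).negOnePow •
          S.insertFrom (S.braceFamily y [w] :: L) N s x := by
      rw [braceFamily, brace_apply, insertFrom_cons_liftAddHom, map_sum, smul_sum]
      refine sum_congr rfl fun a _ => ?_
      rw [insertFrom_cons, map_sum, smul_sum, sum_comm]
      refine sum_congr rfl fun m _ => ?_
      rw [map_sum, smul_sum]
      simp only [insertFrom_nil, Finsupp.liftAddHom_apply_single, AddMonoidHom.finsetSum_apply,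
        AddMonoidHom.comp_apply]
      simp_rw [smul_sum]
      rw [sum_comm]
      refine sum_congr rfl fun i₀ hi₀ => ?_
      rw [mem_Ico] at hi₀
      rw [sum_Ico_eq_sum_range, Nat.Ico_zero_eq_range, Nat.add_sub_cancel_left]
      refine sum_congr rfl fun i hi => ?_
      rw [mem_range] at hi
      rw [insertAt_insertFrom hL' (by omega) (S.circ_mem hi₀.2 hx (hy a)) (hw m),
        S.circ_seq hi₀.2 hi hx (hy a) (hw m)]
      have e₁ : N + a - 1 + m - 1 = N + (a + m - 1) - 1 := by omega
      have e₂ : i₀ + a + m - 1 = i₀ + (a + m - 1) := by omega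
      rw [e₁, e₂]
    have after : ∑ a ∈ y.2.support, ∑ i₀ ∈ Ico s N,
        Finsupp.liftAddHom (fun n => S.insertFrom [w] n (i₀ + a))
          (S.insertFrom L (N + a - 1) (i₀ + a) (S.circ i₀ x (y.2 a))) =
        ∑ r ∈ range (L.length + 1), (pairing w.1 (totalDegree (L.drop r))).negOnePow •
          S.insertFrom (y :: (L.take r ++ w :: L.drop r)) N s x +
        ∑ r ∈ range L.length, (pairing w.1 (totalDegree (L.drop (r + 1)))).negOnePow •
          S.insertFrom (y :: (L.take r ++ S.braceFamily (L.getD r 0) [w] :: L.drop (r + 1))) N s x := by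
      simp_rw [S.insertFrom_cons y, smul_sum]
      rw [sum_comm (s := range (L.length + 1)), sum_comm (s := range L.length), ← sum_add_distrib]
      refine sum_congr rfl fun a _ => ?_
      rw [sum_comm (s := range (L.length + 1)), sum_comm (s := range L.length), ← sum_add_distrib]
      refine sum_congr rfl fun i₀ hi₀ => ?_
      rw [mem_Ico] at hi₀
      exact ih hL' (by omega) (S.circ_mem hi₀.2 hx (hy a))
    rw [List.length_cons, sum_range_succ' _ (L.length + 1), sum_range_succ' (fun r =>
      (pairing w.1 (totalDegree ((y :: L).drop (r + 1)))).negOnePow •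
        S.insertFrom ((y :: L).take r ++ S.braceFamily ((y :: L).getD r 0) [w] ::
          (y :: L).drop (r + 1)) N s x) L.length]
    simp only [List.drop_succ_cons, List.take_succ_cons, List.cons_append, List.drop_zero,
      List.take_zero, List.nil_append, List.getD_cons_succ, List.getD_cons_zero]
    rw [← before, ← inside]
    trans (∑ a ∈ y.2.support, ∑ i₀ ∈ Ico s N,
        Finsupp.liftAddHom (fun n => S.insertFrom [w] n (i₀ + a))
          (S.insertFrom L (N + a - 1) (i₀ + a) (S.circ i₀ x (y.2 a)))) +
      ((∑ a ∈ y.2.support, ∑ i₀ ∈ Ico s N, ∑ m ∈ w.2.support, ∑ i ∈ Ico s i₀,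
        S.insertAt i m (w.2 m) (S.insertFrom L (N + a - 1) (i₀ + a) (S.circ i₀ x (y.2 a)))) +
      ∑ a ∈ y.2.support, ∑ i₀ ∈ Ico s N, ∑ m ∈ w.2.support, ∑ i ∈ Ico i₀ (i₀ + a),
        S.insertAt i m (w.2 m) (S.insertFrom L (N + a - 1) (i₀ + a) (S.circ i₀ x (y.2 a))))
    · rw [S.insertFrom_cons y, map_sum]
      simp only [← sum_add_distrib]
      refine sum_congr rfl fun a _ => ?_
      rw [map_sum]
      refine sum_congr rfl fun i₀ hi₀ => ?_
      rw [mem_Ico] at hi₀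
      rw [liftAddHom_insertFrom_split w L (s := s) (s' := i₀ + a) (by omega) (by omega)]
      congr 1
      refine sum_congr rfl fun m _ => ?_
      rw [sum_Ico_consecutive _ hi₀.1 (by omega)]
    · rw [after]; abel

/-- Insertion into a composite `x ∘ w`, using only inputs from the `t`-th input of `w` on: some of the
families go into `w`, and the others go into inputs of `x` after `w`. -/
theorem insertFrom_circ {L : List (Family T)} (hL : ∀ y ∈ L, S.IsHomogeneous y)
    {N m i t : ℕ} {p e : ℤ × ℤ} (hi : i < N) (ht : t ≤ m) {x w : T} (hx : x ∈ S.homogeneous N p)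
    (hw : w ∈ S.homogeneous m e) :
    S.insertFrom L (N + m - 1) (i + t) (S.circ i x w) =
      ∑ q ∈ range (L.length + 1),
        Finsupp.liftAddHom (fun a => (S.insertFrom (L.drop q) (N + a - 1) (i + a)).comp (S.circ i x))
          (S.insertFrom (L.take q) m t w) := by
  induction L generalizing m t e w with
  | nil => simp
  | cons y L ih =>
    have hy : S.IsHomogeneous y := hL y (by simp)
    rw [List.length_cons, sum_range_succ']
    simp only [List.drop_succ_cons, List.take_succ_cons, List.drop_zero, List.take_zero,
      insertFrom_nil, Finsupp.liftAddHom_apply_single, AddMonoidHom.comp_apply]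
    rw [S.insertFrom_cons y L, S.insertFrom_cons y L]
    simp_rw [S.insertFrom_cons y, map_sum]
    rw [sum_comm (s := range (L.length + 1)), ← sum_add_distrib]
    refine sum_congr rfl fun a _ => ?_
    rw [sum_comm (s := range (L.length + 1)),
      ← sum_Ico_consecutive _ (show i + t ≤ i + m by omega) (show i + m ≤ N + m - 1 by omega)]
    congr 1
    rw [add_comm i t, add_comm i m, ← sum_Ico_add]
    refine sum_congr rfl fun j hj => ?_
    rw [mem_Ico] at hj
    rw [← ih (fun z hz => hL z (by simp [hz])) (by omega) (S.circ_mem hj.2 hw (hy a)),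
      S.circ_seq hi hj.2 hx hw (hy a)]
    have e₁ : N + m - 1 + a - 1 = N + (m + a - 1) - 1 := by omega
    rw [e₁, add_assoc]

/-- Insertion into all composites of `x` with a family `w`, restricted to the inputs from `s` on: the
families go into `x` before `w`, into `w`, or into `x` after `w`. -/
theorem sum_insertFrom_circ {w : Family T} (hw : S.IsHomogeneous w) {L : List (Family T)}
    (hL : ∀ y ∈ L, S.IsHomogeneous y) {N s : ℕ} {p : ℤ × ℤ} {x : T} (hx : x ∈ S.homogeneous N p) :
    ∑ m ∈ w.2.support, ∑ i ∈ Ico s N, S.insertFrom L (N + m - 1) s (S.circ i x (w.2 m)) =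
      ∑ r ∈ range (L.length + 1), ∑ q ∈ range (L.length - r + 1),
        (pairing w.1 (totalDegree (L.take r))).negOnePow •
          S.insertFrom (L.take r ++ S.braceFamily w ((L.drop r).take q) :: L.drop (r + q)) N s x := by
  induction L generalizing N s p x with
  | nil => simp [pairing_zero_right, S.insertFrom_cons, braceFamily]
  | cons y L ih =>
    have hy : S.IsHomogeneous y := hL y (by simp)
    have hL' : ∀ z ∈ L, S.IsHomogeneous z := fun z hz => hL z (by simp [hz])
    -- the part of the sum in which `y` goes into `w` or behind it
    have after : ∑ m ∈ w.2.support, ∑ i ∈ Ico s N,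
        S.insertFrom (y :: L) (N + m - 1) i (S.circ i x (w.2 m)) =
        ∑ q ∈ range ((y :: L).length + 1), (pairing w.1 0).negOnePow •
          S.insertFrom (S.braceFamily w ((y :: L).take q) :: (y :: L).drop q) N s x := by
      simp only [braceFamily, pairing_zero_right, Int.negOnePow_zero, one_smul,
        insertFrom_cons_liftAddHom, brace_apply]
      simp_rw [map_sum]
      rw [sum_comm (s := range _)]
      refine sum_congr rfl fun m _ => ?_
      trans ∑ i ∈ Ico s N, ∑ q ∈ range ((y :: L).length + 1),
        Finsupp.liftAddHom (fun a => (S.insertFrom ((y :: L).drop q) (N + a - 1) (i + a)).comp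
          (S.circ i x)) (S.insertFrom ((y :: L).take q) m 0 (w.2 m))
      · refine sum_congr rfl fun i hi => ?_
        rw [mem_Ico] at hi
        exact insertFrom_circ hL hi.2 (Nat.zero_le _) hx (hw m)
      rw [sum_comm]
      refine sum_congr rfl fun q _ => ?_
      simp only [Finsupp.liftAddHom_apply, Finsupp.sum, AddMonoidHom.finsetSum_apply]
      rw [sum_comm]
    -- the part of the sum in which `y` goes into `x` before `w`
    have before : ∑ m ∈ w.2.support, ∑ i ∈ Ico s N, ∑ a ∈ y.2.support, ∑ i₀ ∈ Ico s i,
        S.insertFrom L (N + m - 1 + a - 1) (i₀ + a) (S.circ i₀ (S.circ i x (w.2 m)) (y.2 a)) =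
        ∑ r ∈ range (L.length + 1), ∑ q ∈ range (L.length - r + 1),
          (pairing w.1 (y.1 + totalDegree (L.take r))).negOnePow •
            S.insertFrom (y :: (L.take r ++ S.braceFamily w ((L.drop r).take q) :: L.drop (r + q)))
              N s x := by
      trans ∑ a ∈ y.2.support, ∑ i₀ ∈ Ico s N, (pairing w.1 y.1).negOnePow •
        ∑ m ∈ w.2.support, ∑ i ∈ Ico (i₀ + a) (N + a - 1),
          S.insertFrom L (N + a - 1 + m - 1) (i₀ + a) (S.circ i (S.circ i₀ x (y.2 a)) (w.2 m))
      · simp_rw [smul_sum, sum_comm (s := Ico s N) (t := w.2.support)]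
        rw [sum_comm (s := y.2.support)]
        refine sum_congr rfl fun m _ => ?_
        rw [sum_comm (t := y.2.support)]
        refine sum_congr rfl fun a _ => ?_
        rw [← sum_Ico_Ico_comm']
        refine sum_congr rfl fun i₀ hi₀ => ?_
        refine sum_nbij' (fun i => i + a - 1) (fun i => i + 1 - a) ?_ ?_ ?_ ?_ ?_
        · intro i h; simp only [mem_Ico] at h ⊢; omega
        · intro i h; simp only [mem_Ico] at h ⊢; omega
        · intro i h; simp only [mem_Ico] at h ⊢; omega
        · intro i h; simp only [mem_Ico] at h ⊢; omega
        · intro i h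
          rw [mem_Ico] at h
          rw [S.circ_par (by omega) h.2 hx (hy a) (hw m), zsmul_unit_map, smul_smul,
            pairing_comm y.1, ← Int.negOnePow_add, Int.negOnePow_even _ ⟨_, rfl⟩, one_smul]
          have e₁ : N + a - 1 + m - 1 = N + m - 1 + a - 1 := by omega
          rw [e₁]
      · simp_rw [S.insertFrom_cons y, smul_sum, pairing_add_right, Int.negOnePow_add, mul_smul]
        trans ∑ a ∈ y.2.support, ∑ i₀ ∈ Ico s N, ∑ r ∈ range (L.length + 1),
          ∑ q ∈ range (L.length - r + 1), (pairing w.1 y.1).negOnePow •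
            (pairing w.1 (totalDegree (L.take r))).negOnePow •
              S.insertFrom (L.take r ++ S.braceFamily w ((L.drop r).take q) :: L.drop (r + q))
                (N + a - 1) (i₀ + a) (S.circ i₀ x (y.2 a))
        · refine sum_congr rfl fun a _ => sum_congr rfl fun i₀ hi₀ => ?_
          rw [mem_Ico] at hi₀
          simp_rw [← smul_sum]
          rw [ih hL' (S.circ_mem hi₀.2 hx (hy a))]
          simp_rw [← smul_sum]
        · simp_rw [sum_comm (s := Ico s N) (t := range _)]
          simp_rw [sum_comm (s := y.2.support) (t := range _)]
    trans (∑ m ∈ w.2.support, ∑ i ∈ Ico s N, ∑ a ∈ y.2.support, ∑ i₀ ∈ Ico s i,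
        S.insertFrom L (N + m - 1 + a - 1) (i₀ + a) (S.circ i₀ (S.circ i x (w.2 m)) (y.2 a))) +
      ∑ m ∈ w.2.support, ∑ i ∈ Ico s N,
        S.insertFrom (y :: L) (N + m - 1) i (S.circ i x (w.2 m))
    · simp only [← sum_add_distrib, S.insertFrom_cons y]
      refine sum_congr rfl fun m _ => sum_congr rfl fun i hi => sum_congr rfl fun a _ => ?_
      rw [mem_Ico] at hi
      rw [sum_Ico_consecutive _ hi.1 (by omega)]
    · rw [before, after]
      conv_rhs => rw [List.length_cons, sum_range_succ']
      simp [Nat.add_right_comm]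

/-- Composition of braces: `(x{w}){L}` is the sum of all `± x{L₁, w{L₂}, L₃}` over the decompositions
`L = L₁ L₂ L₃`. -/
theorem brace_brace_singleton {x w : Family T} (hx : S.IsHomogeneous x) (hw : S.IsHomogeneous w)
    {L : List (Family T)} (hL : ∀ y ∈ L, S.IsHomogeneous y) :
    S.brace L (S.brace [w] x.2) =
      ∑ r ∈ range (L.length + 1), ∑ q ∈ range (L.length - r + 1),
        (pairing w.1 (totalDegree (L.take r))).negOnePow •
          S.brace (L.take r ++ S.braceFamily w ((L.drop r).take q) :: L.drop (r + q)) x.2 := by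
  rw [S.brace_apply [w], map_sum]
  simp_rw [S.brace_apply (_ ++ _), smul_sum]
  trans ∑ N ∈ x.2.support, ∑ r ∈ range (L.length + 1), ∑ q ∈ range (L.length - r + 1),
    (pairing w.1 (totalDegree (L.take r))).negOnePow •
      S.insertFrom (L.take r ++ S.braceFamily w ((L.drop r).take q) :: L.drop (r + q)) N 0 (x.2 N)
  · refine sum_congr rfl fun N _ => ?_
    rw [← sum_insertFrom_circ hw hL (hx N)]
    simp [insertFrom_cons, brace_single]
  · simp_rw [sum_comm (s := x.2.support)]

/-- Composition of braces: `(x{L}){w}` is the sum of all `± x{L₁, w, L₂}` and all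
`± x{L₁, y{w}, L₂}`. -/
theorem brace_singleton_brace {x w : Family T} (hx : S.IsHomogeneous x) (hw : S.IsHomogeneous w)
    {L : List (Family T)} (hL : ∀ y ∈ L, S.IsHomogeneous y) :
    S.brace [w] (S.brace L x.2) =
      ∑ r ∈ range (L.length + 1), (pairing w.1 (totalDegree (L.drop r))).negOnePow •
          S.brace (L.take r ++ w :: L.drop r) x.2 +
        ∑ r ∈ range L.length, (pairing w.1 (totalDegree (L.drop (r + 1)))).negOnePow •
          S.brace (L.take r ++ S.braceFamily (L.getD r 0) [w] :: L.drop (r + 1)) x.2 := by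
  rw [S.brace_apply L, map_sum]
  simp_rw [S.brace_apply (_ ++ _), smul_sum]
  rw [sum_comm (s := range (L.length + 1)), sum_comm (s := range L.length), ← sum_add_distrib]
  refine sum_congr rfl fun N _ => ?_
  exact liftAddHom_insertFrom_insertFrom hw hL (Nat.zero_le _) (hx N)

/-! ### Braces depend on finitely many arities -/

theorem insertFrom_apply_eq_zero_of_add_lt (L : List (Family T)) {N k : ℕ} (s : ℕ)
    (h : k + L.length < N) (x : T) : S.insertFrom L N s x k = 0 := by
  induction L generalizing N s x with
  | nil => simp [Finsupp.single_apply] at h ⊢; omega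
  | cons y L ih =>
    rw [List.length_cons] at h
    rw [insertFrom_cons, Finsupp.finsetSum_apply]
    refine sum_eq_zero fun a _ => ?_
    rw [Finsupp.finsetSum_apply]
    exact sum_eq_zero fun i hi => ih _ (by omega) _

theorem insertFrom_cons_apply (y : Family T) (L : List (Family T)) (N s : ℕ) (x : T) {k K : ℕ}
    (h : k + L.length + 1 < K) : S.insertFrom (y :: L) N s x k =
      ∑ a ∈ range K, ∑ i ∈ Ico s N, S.insertFrom L (N + a - 1) (i + a) (S.circ i x (y.2 a)) k := by
  rw [insertFrom_cons, Finsupp.finsetSum_apply]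
  simp_rw [Finsupp.finsetSum_apply]
  refine sum_congr_of_eq_on_inter (fun a _ ha => ?_) (fun a _ ha => ?_) fun _ _ _ => rfl
  · rw [mem_range, not_lt] at ha
    refine sum_eq_zero fun i hi => insertFrom_apply_eq_zero_of_add_lt _ _ ?_ _
    rw [mem_Ico] at hi
    omega
  · simp [Finsupp.notMem_support_iff.1 ha]

theorem brace_apply_apply (L : List (Family T)) (x : ℕ →₀ T) {k K : ℕ} (h : k + L.length < K) :
    S.brace L x k = ∑ N ∈ range K, S.insertFrom L N 0 (x N) k := by
  rw [brace_apply, Finsupp.finsetSum_apply]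
  refine sum_congr_of_eq_on_inter (fun a _ ha => ?_) (fun a _ ha => ?_) fun _ _ _ => rfl
  · rw [mem_range, not_lt] at ha
    exact insertFrom_apply_eq_zero_of_add_lt _ _ (by omega) _
  · simp [Finsupp.notMem_support_iff.1 ha]

theorem insertFrom_apply_congr {L L' : List (Family T)} {K : ℕ}
    (hL : List.Forall₂ (fun y y' : Family T => ∀ a < K, y.2 a = y'.2 a) L L') (N s : ℕ) (x : T) {k : ℕ}
    (h : k + L.length < K) : S.insertFrom L N s x k = S.insertFrom L' N s x k := by
  induction hL generalizing N s x with
  | nil => rfl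
  | @cons y y' L L' hy hL ih =>
    rw [List.length_cons] at h
    rw [insertFrom_cons_apply y L N s x (K := K) (by omega),
      insertFrom_cons_apply y' L' N s x (K := K) (by rw [← hL.length_eq]; omega)]
    refine sum_congr rfl fun a ha => sum_congr rfl fun i _ => ?_
    rw [hy a (mem_range.1 ha), ih _ _ _ (by omega)]

theorem brace_apply_congr {L L' : List (Family T)} {K : ℕ}
    (hL : List.Forall₂ (fun y y' : Family T => ∀ a < K, y.2 a = y'.2 a) L L') {x x' : ℕ →₀ T}
    (hx : ∀ a < K, x a = x' a) {k : ℕ} (h : k + L.length < K) : S.brace L x k = S.brace L' x' k := by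
  rw [brace_apply_apply L x h, brace_apply_apply L' x' (hL.length_eq ▸ h)]
  refine sum_congr rfl fun N hN => ?_
  rw [hx N (mem_range.1 hN), insertFrom_apply_congr hL _ _ _ h]

theorem brace_apply_eq_zero (L : List (Family T)) {x : ℕ →₀ T} {k : ℕ}
    (hx : ∀ a ≤ k + L.length, x a = 0) : S.brace L x k = 0 := by
  rw [brace_apply_apply L x (Nat.lt_succ_self _)]
  exact sum_eq_zero fun N hN => by rw [hx N (Nat.lt_succ_iff.1 (mem_range.1 hN))]; simp

theorem brace_singleton_apply_eq_zero {y : Family T} (x : ℕ →₀ T) {k : ℕ}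
    (hy : ∀ a ≤ k + 1, y.2 a = 0) : S.brace [y] x k = 0 := by
  rw [brace_apply_congr (K := k + 2) (L' := [(y.1, 0)]) (x' := x) (by simpa [Nat.lt_succ_iff] using hy)
    (fun _ _ => rfl) (by simp)]
  simp [brace_apply, insertFrom_cons]

/-! ### The operations of a family with vanishing twisted square -/

variable (S) in
/-- The term `∓ y{μ}` in the operation of arity one. -/
noncomputable def correction (μ : Family T) (L : List (Family T)) : ℕ →₀ T :=
  if L.length = 1 then
    -((pairing (totalDegree L) μ.1).negOnePow • S.brace [μ] (L.headD 0).2) else 0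

variable (S) in
/-- The operation `L ↦ μ{L}`, and `y ↦ μ{y} ∓ y{μ}` in arity one. -/
noncomputable def operation (μ : Family T) (L : List (Family T)) : Family T :=
  (μ.1 + totalDegree L, S.brace L μ.2 + S.correction μ L)

variable (S) in
/-- The sum of all `± μ{L₁, ν{L₂}, L₃}` with `L₂` not empty. -/
noncomputable def nestedBrace (μ ν : Family T) (L : List (Family T)) : ℕ →₀ T :=
  ∑ r ∈ range L.length, ∑ q ∈ range (L.length - r),
    (pairing ν.1 (totalDegree (L.take r))).negOnePow •
      S.brace (L.take r ++ S.braceFamily ν ((L.drop r).take (q + 1)) :: L.drop (r + q + 1)) μ.2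

variable (S) in
/-- The sum of all `± μ{L₁, ν, L₂}`. -/
noncomputable def insertedBrace (μ ν : Family T) (L : List (Family T)) : ℕ →₀ T :=
  ∑ r ∈ range (L.length + 1), (pairing ν.1 (totalDegree (L.take r))).negOnePow •
    S.brace (L.take r ++ ν :: L.drop r) μ.2

variable (S) in
/-- The sum of all `± μ{L₁, y{ν}, L₂}`. -/
noncomputable def actedBrace (μ ν : Family T) (L : List (Family T)) : ℕ →₀ T :=
  ∑ r ∈ range L.length, (pairing ν.1 (totalDegree (L.take (r + 1)))).negOnePow •
    S.brace (L.take r ++ S.braceFamily (L.getD r 0) [ν] :: L.drop (r + 1)) μ.2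

theorem brace_brace_eq {μ ν : Family T} (hμ : S.IsHomogeneous μ) (hν : S.IsHomogeneous ν)
    {L : List (Family T)} (hL : ∀ y ∈ L, S.IsHomogeneous y) :
    S.brace L (S.brace [ν] μ.2) = S.nestedBrace μ ν L + S.insertedBrace μ ν L := by
  rw [brace_brace_singleton hμ hν hL, nestedBrace, insertedBrace]
  simp_rw [sum_range_succ' _ (L.length - _)]
  rw [sum_add_distrib]
  congr 1
  · rw [sum_range_succ]
    simp [add_assoc]
  · simp [braceFamily]

theorem totalDegree_take_add_drop (L : List (Family T)) (r : ℕ) :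
    totalDegree (L.take r) + totalDegree (L.drop r) = totalDegree L := by
  rw [← totalDegree_append, List.take_append_drop]

theorem brace_singleton_brace_eq {μ ν : Family T} (hμ : S.IsHomogeneous μ) (hν : S.IsHomogeneous ν)
    {L : List (Family T)} (hL : ∀ y ∈ L, S.IsHomogeneous y) :
    (pairing (totalDegree L) ν.1).negOnePow • S.brace [ν] (S.brace L μ.2) =
      S.insertedBrace μ ν L + S.actedBrace μ ν L := by
  have sign (r : ℕ) : (pairing (totalDegree L) ν.1).negOnePow *
      (pairing ν.1 (totalDegree (L.drop r))).negOnePow =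
      (pairing ν.1 (totalDegree (L.take r))).negOnePow := by
    rw [← totalDegree_take_add_drop L r, pairing_comm _ ν.1, pairing_add_right,
      ← Int.negOnePow_add, Int.negOnePow_eq_iff]
    exact ⟨pairing ν.1 (totalDegree (L.drop r)), by ring⟩
  rw [brace_singleton_brace hμ hν hL, insertedBrace, actedBrace, smul_add, smul_sum, smul_sum]
  simp_rw [smul_smul, sign]

/-- The sum of the composites of two operations is the sum of composites of braces, together with
the contributions of the corrections. -/
theorem sum_operation_operation (μ ν : Family T) (L : List (Family T)) (hL : 1 ≤ L.length) :
    ∑ r ∈ range L.length, ∑ q ∈ range (L.length - r),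
      (pairing ν.1 (totalDegree (L.take r))).negOnePow •
        (S.operation μ (L.take r ++ S.operation ν ((L.drop r).take (q + 1)) ::
          L.drop (r + q + 1))).2 =
    S.nestedBrace μ ν L - S.actedBrace μ ν L -
      (pairing (ν.1 + totalDegree L) μ.1).negOnePow • S.brace [μ] (S.brace L ν.2) -
      (pairing (ν.1 + totalDegree L) μ.1).negOnePow • S.brace [μ] (S.correction ν L) := by
  -- the correction of the outer operation occurs only for `r = 0` and `q + 1 = L.length`
  have outer : ∑ r ∈ range L.length, ∑ q ∈ range (L.length - r),
      (pairing ν.1 (totalDegree (L.take r))).negOnePow •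
        S.correction μ (L.take r ++ S.operation ν ((L.drop r).take (q + 1)) :: L.drop (r + q + 1)) =
      - ((pairing (ν.1 + totalDegree L) μ.1).negOnePow • S.brace [μ] (S.brace L ν.2) +
      (pairing (ν.1 + totalDegree L) μ.1).negOnePow • S.brace [μ] (S.correction ν L)) := by
    rw [sum_eq_single_of_mem 0 (mem_range.2 hL), sum_eq_single_of_mem (L.length - 1) (by simp; omega)]
    · have h1 : L.length - 1 + 1 = L.length := by omega
      simp [h1, correction, operation, pairing_zero_right]
    · intro q hq hq'
      rw [mem_range] at hq
      rw [correction, if_neg, smul_zero]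
      simp
      omega
    · intro r hr hr'
      rw [mem_range] at hr
      refine sum_eq_zero fun q hq => ?_
      rw [mem_range] at hq
      rw [correction, if_neg, smul_zero]
      simp
      omega
  -- the correction of the inner operation occurs only for `q = 0`
  have inner : ∑ r ∈ range L.length, ∑ q ∈ range (L.length - r),
      (pairing ν.1 (totalDegree (L.take r))).negOnePow •
        S.brace (L.take r ++ S.operation ν ((L.drop r).take (q + 1)) :: L.drop (r + q + 1)) μ.2 =
      S.nestedBrace μ ν L - S.actedBrace μ ν L := by
    rw [nestedBrace, actedBrace, ← sum_sub_distrib]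
    refine sum_congr rfl fun r hr => ?_
    rw [mem_range] at hr
    obtain ⟨n, hn⟩ : ∃ n, L.length - r = n + 1 := ⟨L.length - r - 1, by omega⟩
    rw [hn, sum_range_succ', sum_range_succ', add_sub_assoc]
    congr 1
    · refine sum_congr rfl fun q hq => ?_
      rw [mem_range] at hq
      have : S.correction ν ((L.drop r).take (q + 1 + 1)) = 0 := by
        rw [correction, if_neg]
        simp; omega
      rw [operation, this, add_zero, braceFamily]
    · have h1 : (L.drop r).take (0 + 1) = [L.getD r 0] := by
        rw [List.drop_eq_getElem_cons hr, zero_add, List.take_succ_cons, List.take_zero,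
          List.getD_eq_getElem _ _ hr]
      have h2 : L.take (r + 1) = L.take r ++ [L.getD r 0] := by
        rw [List.take_add, h1]
      obtain ⟨φ, hφ⟩ := S.exists_brace_eq (L.take r) (L.drop (r + 1)) μ.2
      rw [h1, h2, hφ, add_zero, hφ, hφ, operation, map_add, smul_add, braceFamily, sub_eq_add_neg]
      congr 1
      simp only [correction, List.length_singleton, if_true, List.headD_cons, braceFamily,
        totalDegree_cons, totalDegree_nil, add_zero, map_neg, zsmul_unit_map, totalDegree_append,
        pairing_add_right, Int.negOnePow_add, mul_smul, smul_neg, pairing_comm _ ν.1]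
  rw [sub_sub _ _ ((pairing (ν.1 + totalDegree L) μ.1).negOnePow • S.brace [μ] (S.correction ν L)),
    sub_eq_add_neg, ← outer, ← inner]
  simp_rw [← sum_add_distrib, ← smul_add]
  rfl

theorem sum_antidiagonal_comm {M : Type*} [AddCommMonoid M] (u : ℕ) (f : ℕ → ℕ → M) :
    ∑ ip ∈ antidiagonal u, f ip.1 ip.2 = ∑ ip ∈ antidiagonal u, f ip.2 ip.1 :=
  (Nat.sum_antidiagonal_swap (f := fun ip : ℕ × ℕ => f ip.1 ip.2) (n := u)).symm

theorem finsupp_unit_smul_apply (e : ℤˣ) (f : ℕ →₀ T) (k : ℕ) : (e • f) k = e • f k := by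
  simp [Units.smul_def]

/-- The contributions of `(y{ν}){μ}` to the relation in arity one cancel. -/
theorem sum_brace_correction_eq_zero {μ : ℕ → Family T} (hμ : ∀ i, S.IsHomogeneous (μ i))
    (hdeg : ∀ i, (μ i).1 = ((i : ℤ), 1 - (i : ℤ))) {u K : ℕ}
    (rel : ∀ v < K, ∑ ip ∈ antidiagonal u, (ip.2 : ℤ).negOnePow •
      S.brace [μ ip.2] (μ ip.1).2 v = 0)
    {L : List (Family T)} (hL : ∀ y ∈ L, S.IsHomogeneous y) {k : ℕ} (hk : k + L.length < K) :
    (∑ ip ∈ antidiagonal u, (ip.2 : ℤ).negOnePow •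
      (pairing ((μ ip.2).1 + totalDegree L) (μ ip.1).1).negOnePow •
        S.brace [μ ip.1] (S.correction (μ ip.2) L)) k = 0 := by
  by_cases hc : L.length = 1
  swap
  · simp [correction, hc]
  obtain ⟨y, rfl⟩ := List.length_eq_one_iff.1 hc
  have hy : S.IsHomogeneous y := hL y (by simp)
  have term (i p : ℕ) (hip : i + p = u) : (p : ℤ).negOnePow •
      (pairing ((μ p).1 + totalDegree [y]) (μ i).1).negOnePow •
        S.brace [μ i] (S.correction (μ p) [y]) =
      (pairing y.1 ((u : ℤ), 2 - (u : ℤ))).negOnePow •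
        (((p : ℤ) + 1).negOnePow • S.brace [μ i, μ p] y.2 + (i : ℤ).negOnePow • S.brace [μ p, μ i] y.2
          + (i : ℤ).negOnePow • S.brace [S.braceFamily (μ p) [μ i]] y.2) := by
    have h := brace_singleton_brace hy (hμ i) (L := [μ p]) (by simpa using hμ p)
    simp only [List.length_singleton, sum_range_succ, sum_range_zero, List.drop_zero,
      List.take_zero, List.nil_append, List.drop_succ_cons, List.drop_nil, List.take_succ_cons,
      List.take_nil, List.cons_append, totalDegree_cons, totalDegree_nil, zero_add, add_zero,
      pairing_zero_right, Int.negOnePow_zero, one_smul, List.getD_cons_zero] at h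
    -- as `|μ i| + |μ p| = (u, 2 - u)`, the common sign does not depend on `i` and `p`
    have e₁ : (p : ℤ).negOnePow * ((pairing ((μ p).1 + y.1) (μ i).1).negOnePow *
        (pairing y.1 (μ p).1).negOnePow) =
        -((pairing y.1 ((u : ℤ), 2 - (u : ℤ))).negOnePow * (i : ℤ).negOnePow) := by
      rw [hdeg, hdeg, ← mul_neg, ← Int.negOnePow_succ, ← Int.negOnePow_add, ← Int.negOnePow_add,
        ← Int.negOnePow_add, Int.negOnePow_eq_iff, ← hip]
      simp only [pairing, Prod.fst_add, Prod.snd_add]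
      push_cast
      exact ⟨p * i - i, by ring⟩
    have e₂ : (i : ℤ).negOnePow * (pairing (μ i).1 (μ p).1).negOnePow = ((p : ℤ) + 1).negOnePow := by
      rw [hdeg, hdeg, ← Int.negOnePow_add, Int.negOnePow_eq_iff]
      simp only [pairing]
      exact ⟨p * i - p, by ring⟩
    rw [correction, if_pos hc, List.headD_cons, totalDegree_cons, totalDegree_nil, add_zero, map_neg,
      zsmul_unit_map, h, smul_neg, smul_neg, smul_smul, smul_smul, mul_assoc, e₁, Units.neg_smul, neg_neg,
      mul_smul, ← e₂]
    simp only [smul_add, mul_smul]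
  obtain ⟨φ, hφ⟩ := S.exists_brace_eq [] [] y.2
  have h : ∑ ip ∈ antidiagonal u, (ip.1 : ℤ).negOnePow •
      S.brace [S.braceFamily (μ ip.2) [μ ip.1]] y.2 =
      S.brace [(0, ∑ ip ∈ antidiagonal u, (ip.2 : ℤ).negOnePow • S.brace [μ ip.2] (μ ip.1).2)] y.2 := by
    rw [sum_antidiagonal_comm u fun i p => (i : ℤ).negOnePow •
      S.brace [S.braceFamily (μ p) [μ i]] y.2]
    refine Eq.trans ?_ (hφ _).symm
    rw [map_sum]
    refine sum_congr rfl fun ip _ => ?_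
    rw [zsmul_unit_map]
    exact congrArg _ (hφ _)
  rw [sum_congr rfl fun ip hip => term ip.1 ip.2 (mem_antidiagonal.1 hip), ← smul_sum,
    sum_add_distrib, sum_add_distrib, h, sum_antidiagonal_comm u fun i p => ((p : ℤ) + 1).negOnePow •
      S.brace [μ i, μ p] y.2, ← sum_add_distrib, sum_eq_zero, zero_add, finsupp_unit_smul_apply,
    brace_singleton_apply_eq_zero, smul_zero]
  · intro a ha
    rw [← rel a (by simp at hk; omega)]
    simp [Finsupp.finsetSum_apply, finsupp_unit_smul_apply]
  · intro ip _
    rw [Int.negOnePow_succ, Units.neg_smul, neg_add_cancel]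

/-- The derived `A_∞`-relation for the operations of a family `μ` whose members satisfy
`∑_{i + p = u} (-1)^p μ_i{μ_p} = 0` in the arities below `K`. -/
theorem sum_operation_operation_eq_zero {μ : ℕ → Family T} (hμ : ∀ i, S.IsHomogeneous (μ i))
    (hdeg : ∀ i, (μ i).1 = ((i : ℤ), 1 - (i : ℤ))) {u K : ℕ}
    (rel : ∀ v < K, ∑ ip ∈ antidiagonal u, (ip.2 : ℤ).negOnePow •
      S.brace [μ ip.2] (μ ip.1).2 v = 0)
    {L : List (Family T)} (hL : ∀ y ∈ L, S.IsHomogeneous y) (hL₁ : 1 ≤ L.length) {k : ℕ}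
    (hk : k + L.length < K) :
    ∑ ip ∈ antidiagonal u, ∑ r ∈ range L.length, ∑ q ∈ range (L.length - r),
      (ip.2 : ℤ).negOnePow • (pairing (μ ip.2).1 (totalDegree (L.take r))).negOnePow •
        (S.operation (μ ip.1) (L.take r ++ S.operation (μ ip.2) ((L.drop r).take (q + 1)) ::
          L.drop (r + q + 1))).2 k = 0 := by
  -- `⟨μ p, μ i⟩ = 1 + p + i` modulo 2, so that the second composition identity for `(μ p){L}{μ i}`
  -- yields terms with the sign of the summand where `i` and `p` are exchanged
  have h₁ (i p : ℕ) : (p : ℤ).negOnePow •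
      (pairing ((μ p).1 + totalDegree L) (μ i).1).negOnePow • S.brace [μ i] (S.brace L (μ p).2) =
      ((i : ℤ) + 1).negOnePow • (S.insertedBrace (μ p) (μ i) L + S.actedBrace (μ p) (μ i) L) := by
    rw [← brace_singleton_brace_eq (hμ p) (hμ i) hL, pairing_add_left, Int.negOnePow_add, mul_smul,
      smul_smul, ← Int.negOnePow_add]
    congr 1
    rw [Int.negOnePow_eq_iff, hdeg, hdeg]
    simp only [pairing]
    exact ⟨p * i - i, by ring⟩
  have h₂ : ∑ ip ∈ antidiagonal u, (ip.2 : ℤ).negOnePow •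
      ∑ r ∈ range L.length, ∑ q ∈ range (L.length - r),
        (pairing (μ ip.2).1 (totalDegree (L.take r))).negOnePow •
          (S.operation (μ ip.1) (L.take r ++ S.operation (μ ip.2) ((L.drop r).take (q + 1)) ::
            L.drop (r + q + 1))).2 =
      S.brace L (∑ ip ∈ antidiagonal u, (ip.2 : ℤ).negOnePow • S.brace [μ ip.2] (μ ip.1).2) -
      ∑ ip ∈ antidiagonal u, (ip.2 : ℤ).negOnePow •
        (pairing ((μ ip.2).1 + totalDegree L) (μ ip.1).1).negOnePow •
          S.brace [μ ip.1] (S.correction (μ ip.2) L) := by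
    simp_rw [sum_operation_operation _ _ L hL₁, smul_sub, h₁, map_sum, zsmul_unit_map,
      brace_brace_eq (hμ _) (hμ _) hL]
    rw [sum_sub_distrib]
    congr 1
    rw [sum_sub_distrib, sum_antidiagonal_comm u (fun i p => ((i : ℤ) + 1).negOnePow •
      (S.insertedBrace (μ p) (μ i) L + S.actedBrace (μ p) (μ i) L)), ← sum_sub_distrib]
    refine sum_congr rfl fun ip _ => ?_
    rw [Int.negOnePow_succ, Units.neg_smul, smul_add, smul_add]
    abel
  have h₃ := DFunLike.congr_fun h₂ k
  rw [Finsupp.sub_apply, sum_brace_correction_eq_zero hμ hdeg rel hL hk, sub_zero,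
    brace_apply_eq_zero] at h₃
  · rw [← h₃]
    simp [Finsupp.finsetSum_apply, finsupp_unit_smul_apply, smul_sum]
  · intro a ha
    rw [← rel a (by omega)]
    simp [Finsupp.finsetSum_apply, finsupp_unit_smul_apply]

/-! ### The insertion system of a bigraded operad -/

variable (S)

theorem ofFn_update {α : Type*} {j : ℕ} (f : Fin j → α) (i : Fin j) (y : α) :
    List.ofFn (Function.update f i y) = (List.ofFn f).take i ++ y :: (List.ofFn f).drop (i + 1) := by
  have h : List.ofFn (Function.update f i y) = (List.ofFn f).set i y := by
    refine List.ext_getElem (by simp) fun n h₁ h₂ => ?_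
    simp [List.getElem_set, Function.update_apply, Fin.ext_iff, eq_comm]
  rw [h, List.set_eq_take_append_cons_drop, if_pos (by simp)]

/-- The insertion of `j` families as a multiadditive map. -/
noncomputable def insertMultilinear {j : ℕ} (p : Fin j → ℤ × ℤ) (N s : ℕ) (x : T) :
    MultilinearMap ℤ (fun _ : Fin j => ℕ →₀ T) (ℕ →₀ T) where
  toFun y := S.insertFrom (List.ofFn fun v => (p v, y v)) N s x
  map_update_add' := by
    intro _ y i a b
    have key (c : ℕ →₀ T) : (fun v => (p v, Function.update y i c v)) =
        Function.update (fun v => (p v, y v)) i (p i, c) := by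
      ext v : 1
      by_cases h : v = i
      · subst h; simp
      · simp [h]
    obtain ⟨φ, hφ⟩ := S.exists_insertFrom_eq ((List.ofFn fun v => (p v, y v)).take i)
      ((List.ofFn fun v => (p v, y v)).drop (i + 1)) N s x
    obtain rfl : ‹DecidableEq (Fin j)› = instDecidableEqFin j := Subsingleton.elim _ _
    rw [key, key, key, ofFn_update, ofFn_update, ofFn_update, hφ, hφ, hφ, map_add]
  map_update_smul' := by
    intro _ y i a b
    have key (c : ℕ →₀ T) : (fun v => (p v, Function.update y i c v)) =
        Function.update (fun v => (p v, y v)) i (p i, c) := by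
      ext v : 1
      by_cases h : v = i
      · subst h; simp
      · simp [h]
    obtain ⟨φ, hφ⟩ := S.exists_insertFrom_eq ((List.ofFn fun v => (p v, y v)).take i)
      ((List.ofFn fun v => (p v, y v)).drop (i + 1)) N s x
    obtain rfl : ‹DecidableEq (Fin j)› = instDecidableEqFin j := Subsingleton.elim _ _
    rw [key, key, ofFn_update, ofFn_update, hφ, hφ, map_zsmul]

/-- The family of the elements `f a` in the arities `a` below `K`. -/
noncomputable def truncate (K : ℕ) (f : ℕ → T) : ℕ →₀ T := ∑ a ∈ range K, Finsupp.single a (f a)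

theorem truncate_apply (K : ℕ) (f : ℕ → T) (a : ℕ) : truncate K f a = if a < K then f a else 0 := by
  simp [truncate, Finsupp.finsetSum_apply, Finsupp.single_apply]

theorem insertFrom_truncate {j : ℕ} (p : Fin j → ℤ × ℤ) (y : Fin j → ℕ → T) (K N s : ℕ) (x : T) :
    S.insertFrom (List.ofFn fun v => (p v, truncate K (y v))) N s x =
      ∑ c ∈ Fintype.piFinset fun _ : Fin j => range K,
        S.insertFrom (List.ofFn fun v => (p v, Finsupp.single (c v) (y v (c v)))) N s x :=
  (S.insertMultilinear p N s x).map_sum_finset (fun v a => Finsupp.single a (y v a)) fun _ => range K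

/-- Insertions into an element of arity `N` lead to the arity given by counting inputs. -/
theorem insertFrom_single_apply_eq_zero {j : ℕ} (p : Fin j → ℤ × ℤ) (c : Fin j → ℕ) (y : Fin j → T)
    {N s : ℕ} (x : T) {k : ℕ} (h : N + ∑ v, c v ≠ k + j) :
    S.insertFrom (List.ofFn fun v => (p v, Finsupp.single (c v) (y v))) N s x k = 0 := by
  induction j generalizing N s x with
  | zero => simp [Finsupp.single_apply] at h ⊢; omega
  | succ j ih =>
    rw [List.ofFn_succ, insertFrom_cons_liftAddHom, Finsupp.liftAddHom_apply_single,
      AddMonoidHom.finsetSum_apply, Finsupp.finsetSum_apply]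
    refine sum_eq_zero fun i hi => ?_
    rw [mem_Ico] at hi
    rw [Fin.sum_univ_succ] at h
    exact ih (fun v => p v.succ) (fun v => c v.succ) (fun v => y v.succ) _ (by omega)

end InsertionSystem

namespace BigradedOperad

open InsertionSystem Finset

variable {R : Type v} [CommRing R] (P : BigradedOperad.{u} R)

/-- The direct sum of all the modules of an operad. -/
abbrev Elements : Type u := DirectSum (ℕ × (ℤ × ℤ)) fun np => P.obj np.1 np.2

/-- The inclusion of the elements of one arity and bidegree. -/
def incl (n : ℕ) (p : ℤ × ℤ) : P.obj n p →+ P.Elements :=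
  DirectSum.of (fun np : ℕ × (ℤ × ℤ) => P.obj np.1 np.2) (n, p)

theorem incl_cast {n k : ℕ} {p q : ℤ × ℤ} (hn : n = k) (hp : p = q) (x : P.obj n p) :
    P.incl k q (P.cast hn hp x) = P.incl n p x := by
  subst hn hp; rfl

/-- The insertion into the input `i`, on homogeneous elements; it is zero if there is no such
input. -/
def circHom (i : ℕ) (np mq : ℕ × (ℤ × ℤ)) :
    P.obj np.1 np.2 →+ P.obj mq.1 mq.2 →+ P.Elements :=
  if h : i < np.1 then
    AddMonoidHom.mk' (fun x => (P.incl _ _).comp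
      (P.circ (k := np.1 + mq.1 - 1) (by omega) ⟨i, h⟩ rfl x).toAddMonoidHom)
      (by intro x y; ext z; simp)
  else 0

/-- The insertion into the input `i` on the direct sum of all the modules. -/
def circTotal (i : ℕ) : P.Elements →+ P.Elements →+ P.Elements :=
  DirectSum.toAddMonoid fun np =>
    (DirectSum.toAddMonoid fun mq => (P.circHom i np mq).flip).flip

theorem circTotal_incl {n m k : ℕ} (hk : k + 1 = n + m) {i : ℕ} (hi : i < n) {p q s : ℤ × ℤ}
    (hs : s = p + q) (x : P.obj n p) (y : P.obj m q) :
    P.circTotal i (P.incl n p x) (P.incl m q y) = P.incl k s (P.circ hk ⟨i, hi⟩ hs x y) := by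
  obtain rfl : k = n + m - 1 := by omega
  subst hs
  simp only [circTotal, incl, DirectSum.toAddMonoid_of, AddMonoidHom.flip_apply]
  simp only [circHom, hi, dif_pos]
  rfl

/-- The insertion system of an operad. -/
def insertionSystem : InsertionSystem P.Elements where
  homogeneous n p := (P.incl n p).range
  circ := P.circTotal
  circ_mem := by
    rintro n m i p q _ _ hi ⟨x, rfl⟩ ⟨y, rfl⟩
    rw [P.circTotal_incl (k := n + m - 1) (by omega) hi rfl]
    exact ⟨_, rfl⟩
  circ_seq := by
    rintro l m n i j p q r _ _ _ hi hj ⟨x, rfl⟩ ⟨y, rfl⟩ ⟨z, rfl⟩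
    rw [P.circTotal_incl (k := l + m - 1) (by omega) hi rfl,
      P.circTotal_incl (k := l + m - 1 + n - 1) (by omega) (by omega) rfl,
      P.circTotal_incl (k := m + n - 1) (by omega) hj rfl,
      P.circTotal_incl (k := l + m - 1 + n - 1) (s := p + q + r) (by omega) hi (add_assoc _ _ _)]
    exact congrArg _ (P.circ_seq (by omega) (by omega) (by omega) (by omega) rfl rfl rfl
      (add_assoc _ _ _) ⟨i, hi⟩ ⟨j, hj⟩ x y z)
  circ_par := by
    rintro l m n i j p q r _ _ _ hij hj ⟨x, rfl⟩ ⟨y, rfl⟩ ⟨z, rfl⟩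
    have hw : p + q + r = p + r + q := by abel
    rw [P.circTotal_incl (k := l + m - 1) (by omega) (by omega) rfl,
      P.circTotal_incl (k := l + m - 1 + n - 1) (by omega) (by omega) rfl,
      P.circTotal_incl (k := l + n - 1) (by omega) hj rfl,
      P.circTotal_incl (k := l + m - 1 + n - 1) (s := p + q + r) (by omega) (by omega) hw,
      ← zsmul_unit_map]
    exact congrArg _ (P.circ_par (by omega) (by omega) (by omega) (by omega) rfl rfl rfl
      hw ⟨i, by omega⟩ ⟨j, hj⟩ hij x y z)

/-- The components of arity below `K` of an element of the underlying bigraded module. -/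
noncomputable def truncation (K : ℕ) {p : ℤ × ℤ} (x : P.underlying.obj p) : Family P.Elements :=
  (p, truncate K fun a => P.incl a p (x a))

theorem truncation_apply {K : ℕ} {p : ℤ × ℤ} (x : P.underlying.obj p) {a : ℕ} (ha : a < K) :
    (P.truncation K x).2 a = P.incl a p (x a) := by
  rw [truncation, truncate_apply, if_pos ha]

theorem isHomogeneous_truncation (K : ℕ) {p : ℤ × ℤ} (x : P.underlying.obj p) :
    P.insertionSystem.IsHomogeneous (P.truncation K x) := by
  intro a
  rw [truncation, truncate_apply]
  split_ifs
  · exact ⟨_, rfl⟩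
  · exact zero_mem _

/-- For families with one component each, `insertFrom` is `braceFrom`. -/
theorem insertFrom_incl {j N : ℕ} {p₀ : ℤ × ℤ} (x : P.obj N p₀) (s : ℕ) (a : Fin j → ℕ)
    (p : Fin j → ℤ × ℤ) (y : ∀ v, P.obj (a v) (p v)) (k : ℕ) (hk : k + j = N + ∑ v, a v) (q : ℤ × ℤ)
    (hq : q = p₀ + ∑ v, p v) :
    P.insertionSystem.insertFrom
        (List.ofFn fun v => (p v, Finsupp.single (a v) (P.incl (a v) (p v) (y v)))) N s
        (P.incl N p₀ x) = Finsupp.single k (P.incl k q (P.braceFrom j x s a p y k hk q hq)) := by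
  induction j generalizing N p₀ s with
  | zero =>
    obtain rfl : k = N := by simpa using hk
    rw [braceFrom, incl_cast]
    simp
  | succ j ih =>
    have hIco : Ico s N = {i ∈ range N | s ≤ i} := by ext; simp [and_comm]
    rw [List.ofFn_succ, insertFrom_cons_liftAddHom, Finsupp.liftAddHom_apply_single, braceFrom,
      map_sum, Finsupp.single_finsetSum, AddMonoidHom.finsetSum_apply,
      hIco, sum_filter, sum_range]
    refine sum_congr rfl fun i _ => ?_
    split_ifs with h
    · rw [← ih]
      rw [← P.circTotal_incl _ i.2]
      rfl
    · simp

/-- A component of a brace, computed with truncated families. -/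
theorem incl_brace {j : ℕ} {p₀ : ℤ × ℤ} (x : P.underlying.obj p₀) (p : Fin j → ℤ × ℤ)
    (y : ∀ v, P.underlying.obj (p v)) (q : ℤ × ℤ) (hq : q = p₀ + ∑ v, p v) {k K : ℕ} (hK : k + j < K) :
    P.incl k q (P.brace x p y q hq k) = P.insertionSystem.brace
      (List.ofFn fun v => P.truncation K (y v)) (P.truncation K x).2 k := by
  rw [brace_apply_apply _ _ (K := K) (by simpa using hK)]
  simp_rw [truncation, insertFrom_truncate, Finsupp.finsetSum_apply]
  rw [← sum_product' (range K) (Fintype.piFinset fun _ : Fin j => range K) fun N c =>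
    P.insertionSystem.insertFrom (List.ofFn fun v => (p v, Finsupp.single (c v)
      (P.incl (c v) (p v) (y v (c v))))) N 0 (truncate K (fun a => P.incl a p₀ (x a)) N) k,
    brace, map_sum]
  trans ∑ c ∈ Nat.antidiagonalTuple (j + 1) (k + j),
    P.insertionSystem.insertFrom (List.ofFn fun v => (p v, Finsupp.single (c v.succ)
      (P.incl (c v.succ) (p v) (y v (c v.succ))))) (c 0) 0 (P.incl (c 0) p₀ (x (c 0))) k
  · rw [← sum_attach (Nat.antidiagonalTuple (j + 1) (k + j))]
    refine sum_congr rfl fun c _ => ?_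
    rw [P.insertFrom_incl (x (c.1 0)) 0 (fun v => c.1 v.succ) p (fun v => y v (c.1 v.succ)) k _ q hq,
      Finsupp.single_eq_same]
  -- by arities, only the tuples `(N, c)` with `N + ∑ c = k + j` contribute in arity `k`
  · refine sum_bij_ne_zero (fun c _ _ => (c 0, fun v => c v.succ)) ?_ ?_ ?_ ?_
    · intro c hc _
      rw [Nat.mem_antidiagonalTuple, Fin.sum_univ_succ] at hc
      simp only [mem_product, mem_range, Fintype.mem_piFinset]
      refine ⟨by omega, fun v => ?_⟩
      have := single_le_sum (f := fun v : Fin j => c v.succ) (fun _ _ => Nat.zero_le _) (mem_univ v)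
      omega
    · intro c hc _ c' hc' _ h
      rw [Prod.mk.injEq] at h
      ext v
      refine Fin.cases h.1 (fun v => congrFun h.2 v) v
    · rintro ⟨N, c⟩ hc hne
      have h : N + ∑ v, c v = k + j := by
        by_contra h
        apply hne
        rw [truncate_apply]
        exact insertFrom_single_apply_eq_zero _ _ _ (fun v => P.incl (c v) (p v) (y v (c v))) _ h
      refine ⟨Fin.cons N c, ?_, ?_, ?_⟩
      · rw [Nat.mem_antidiagonalTuple, Fin.sum_univ_succ]
        simpa using h
      · simp only [mem_product, mem_range] at hc
        rw [truncate_apply, if_pos hc.1] at hne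
        exact hne
      · simp
    · intro c hc _
      rw [Nat.mem_antidiagonalTuple, Fin.sum_univ_succ] at hc
      simp only
      rw [truncate_apply, if_pos (by omega)]

end BigradedOperad

namespace BigradedOperad

open InsertionSystem Finset
variable {R : Type v} [CommRing R]

/-! ### Linearity of braces -/

section Linear

variable (P : BigradedOperad.{u} R)

/-- Transport along equalities as a linear map. -/
def castLinear {n k : ℕ} {p q : ℤ × ℤ} (hn : n = k) (hp : p = q) : P.obj n p →ₗ[R] P.obj k q where
  toFun := P.cast hn hp
  map_add' := by subst hn hp; exact fun _ _ => rfl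
  map_smul' := by subst hn hp; exact fun _ _ => rfl

theorem exists_braceFrom_left_eq (j N : ℕ) (p₀ : ℤ × ℤ) (s : ℕ) (a : Fin j → ℕ) (p : Fin j → ℤ × ℤ)
    (y : ∀ v, P.obj (a v) (p v)) (k : ℕ) (hk : k + j = N + ∑ v, a v) (q : ℤ × ℤ)
    (hq : q = p₀ + ∑ v, p v) :
    ∃ φ : P.obj N p₀ →ₗ[R] P.obj k q, ∀ x, P.braceFrom j x s a p y k hk q hq = φ x := by
  induction j generalizing N p₀ s with
  | zero => exact ⟨P.castLinear _ _, fun x => rfl⟩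
  | succ j ih =>
    have h (i : Fin N) := ih (N + a 0 - 1) (p₀ + p 0) (i + a 0) (fun v => a v.succ)
      (fun v => p v.succ) (fun v => y v.succ)
      (by have := i.2; rw [Fin.sum_univ_succ] at hk; omega)
      (by rw [hq, Fin.sum_univ_succ, add_assoc])
    choose φ hφ using h
    refine ⟨∑ i : Fin N, if s ≤ i then (φ i).comp ((P.circ (by have := i.2; omega) i rfl).flip (y 0))
      else 0, fun x => ?_⟩
    rw [braceFrom, LinearMap.sum_apply]
    refine sum_congr rfl fun i _ => ?_
    split_ifs
    · exact hφ i _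
    · rfl

theorem exists_braceFrom_update_eq {j N : ℕ} {p₀ : ℤ × ℤ} (x : P.obj N p₀) (s : ℕ) (a : Fin j → ℕ)
    (p : Fin j → ℤ × ℤ) (y : ∀ v, P.obj (a v) (p v)) (k : ℕ) (hk : k + j = N + ∑ v, a v) (q : ℤ × ℤ)
    (hq : q = p₀ + ∑ v, p v) (i : Fin j) :
    ∃ φ : P.obj (a i) (p i) →ₗ[R] P.obj k q,
      ∀ z, P.braceFrom j x s a p (Function.update y i z) k hk q hq = φ z := by
  induction j generalizing N p₀ s with
  | zero => exact i.elim0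
  | succ j ih =>
    induction i using Fin.cases with
    | zero =>
      have h (b : Fin N) := P.exists_braceFrom_left_eq j (N + a 0 - 1) (p₀ + p 0) (b + a 0)
        (fun v => a v.succ) (fun v => p v.succ) (fun v => y v.succ) k
        (by have := b.2; rw [Fin.sum_univ_succ] at hk; omega) q
        (by rw [hq, Fin.sum_univ_succ, add_assoc])
      choose φ hφ using h
      refine ⟨∑ b : Fin N, if s ≤ b then (φ b).comp (P.circ (by have := b.2; omega) b rfl x)
        else 0, fun z => ?_⟩
      rw [braceFrom, LinearMap.sum_apply]
      refine sum_congr rfl fun b _ => ?_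
      split_ifs
      · simpa using hφ b _
      · rfl
    | succ i =>
      have h (b : Fin N) := ih (P.circ (k := N + a 0 - 1) (by have := b.2; omega) b rfl x (y 0))
        (b + a 0) (fun v => a v.succ) (fun v => p v.succ) (fun v => y v.succ)
        (by have := b.2; rw [Fin.sum_univ_succ] at hk; omega)
        (by rw [hq, Fin.sum_univ_succ, add_assoc]) i
      choose φ hφ using h
      refine ⟨∑ b : Fin N, if s ≤ b then φ b else 0, fun z => ?_⟩
      have hy : (fun v : Fin j => Function.update y i.succ z v.succ) =
          Function.update (fun v : Fin j => y v.succ) i z := by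
        funext v
        by_cases h : v = i
        · subst h; simp
        · simp [h]
      rw [braceFrom, LinearMap.sum_apply]
      refine sum_congr rfl fun b _ => ?_
      split_ifs
      · rw [← hφ, ← hy]
        rfl
      · rfl

theorem exists_brace_left_eq {j : ℕ} (p₀ : ℤ × ℤ) (p : Fin j → ℤ × ℤ)
    (y : ∀ v, P.underlying.obj (p v)) (q : ℤ × ℤ) (hq : q = p₀ + ∑ v, p v) :
    ∃ φ : P.underlying.obj p₀ →ₗ[R] P.underlying.obj q, ∀ x, P.brace x p y q hq = φ x := by
  have h (k : ℕ) (c : {c // c ∈ Nat.antidiagonalTuple (j + 1) (k + j)}) :=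
    P.exists_braceFrom_left_eq j (c.1 0) p₀ 0 (fun v => c.1 v.succ) p (fun v => y v (c.1 v.succ)) k
      (by
        have h := Nat.mem_antidiagonalTuple.1 c.2
        rw [Fin.sum_univ_succ] at h
        exact h.symm) q hq
  choose φ hφ using h
  refine ⟨LinearMap.pi fun k => ∑ c, (φ k c).comp (LinearMap.proj (c.1 0)), fun x => ?_⟩
  funext k
  rw [brace, LinearMap.pi_apply, LinearMap.sum_apply]
  exact sum_congr rfl fun c _ => hφ k c _

theorem exists_brace_update_eq {j : ℕ} {p₀ : ℤ × ℤ} (x : P.underlying.obj p₀) (p : Fin j → ℤ × ℤ)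
    (y : ∀ v, P.underlying.obj (p v)) (q : ℤ × ℤ) (hq : q = p₀ + ∑ v, p v) (i : Fin j) :
    ∃ φ : P.underlying.obj (p i) →ₗ[R] P.underlying.obj q,
      ∀ z, P.brace x p (Function.update y i z) q hq = φ z := by
  have h (k : ℕ) (c : {c // c ∈ Nat.antidiagonalTuple (j + 1) (k + j)}) :=
    P.exists_braceFrom_update_eq (x (c.1 0)) 0 (fun v => c.1 v.succ) p (fun v => y v (c.1 v.succ)) k
      (by
        have h := Nat.mem_antidiagonalTuple.1 c.2
        rw [Fin.sum_univ_succ] at h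
        exact h.symm) q hq i
  choose φ hφ using h
  refine ⟨LinearMap.pi fun k => ∑ c, (φ k c).comp (LinearMap.proj (c.1 i.succ)), fun z => ?_⟩
  funext k
  rw [brace, LinearMap.pi_apply, LinearMap.sum_apply]
  refine sum_congr rfl fun c _ => ?_
  rw [LinearMap.comp_apply, LinearMap.proj_apply, ← hφ]
  congr 1
  funext v
  by_cases h : v = i
  · subst h; simp
  · simp [h]

end Linear

/-- A map that is linear in each variable is multilinear. -/
def multilinearOfExists {ι : Type*} {M : ι → Type*} {N : Type*} [DecidableEq ι] [∀ i, AddCommGroup (M i)]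
    [∀ i, Module R (M i)] [AddCommGroup N] [Module R N] (f : (∀ i, M i) → N)
    (h : ∀ y i, ∃ φ : M i →ₗ[R] N, ∀ z, f (Function.update y i z) = φ z) : MultilinearMap R M N where
  toFun := f
  map_update_add' := by
    intro inst y i a b
    obtain ⟨φ, hφ'⟩ := h y i
    have hφ : ∀ z, f (@Function.update _ _ inst y i z) = φ z := fun z => by
      convert hφ' z
    rw [hφ, hφ, hφ, map_add]
  map_update_smul' := by
    intro inst y i a b
    obtain ⟨φ, hφ'⟩ := h y i
    have hφ : ∀ z, f (@Function.update _ _ inst y i z) = φ z := fun z => by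
      convert hφ' z
    rw [hφ, hφ, map_smul]

/-! ### The structure maps -/

variable (O : BigradedOperad.{u} R) (m : O.DerivedAInftyMultiplication)

/-- The value of `M_{ij}` on homogeneous elements, in the total module. -/
def structureValue (i : ℕ) : ∀ (j : ℕ) (p : Fin j → ℤ × ℤ), (∀ v, O.shiftedSuspension.obj (p v)) →
    O.shiftedSuspension.Total
  | 0, _, _ => 0
  | 1, p, x => O.shiftedSuspension.hom _ (O.arityOneMap m i (p 0) (x 0))
  | _ + 2, p, x => O.shiftedSuspension.hom _ (O.higherMap m i p x)

theorem structureValue_of_two_le (i j : ℕ) (hj : 2 ≤ j) (p : Fin j → ℤ × ℤ)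
    (x : ∀ v, O.shiftedSuspension.obj (p v)) :
    O.structureValue m i j p x = O.shiftedSuspension.hom _ (O.higherMap m i p x) := by
  obtain ⟨j, rfl⟩ := Nat.exists_eq_add_of_le' hj
  rfl

theorem exists_structureValue_update_eq (i j : ℕ) (p : Fin j → ℤ × ℤ)
    (x : ∀ v, O.shiftedSuspension.obj (p v)) (v : Fin j) :
    ∃ φ : O.shiftedSuspension.obj (p v) →ₗ[R] O.shiftedSuspension.Total,
      ∀ z, O.structureValue m i j p (Function.update x v z) = φ z := by
  match j with
  | 0 => exact v.elim0
  | 1 =>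
    obtain rfl : v = 0 := Subsingleton.elim _ _
    set D : ℤ × ℤ := p 0 + ((i : ℤ), 2 - ((i : ℤ) + 1)) with hD
    obtain ⟨φ, hφ⟩ := O.suspension.exists_brace_update_eq (O.multiplication m i)
      (fun _ : Fin 1 => ((p 0).1, (p 0).2 - 1)) (fun _ => x 0) (D.1, D.2 - 1)
      (by ext <;> simp [hD] <;> ring) 0
    obtain ⟨ψ, hψ⟩ := O.suspension.exists_brace_left_eq ((p 0).1, (p 0).2 - 1)
      (fun _ : Fin 1 => ((i : ℤ), 1 - (i : ℤ))) (fun _ => O.multiplication m i) (D.1, D.2 - 1)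
      (by ext <;> simp [hD]; ring)
    refine ⟨(DirectSum.lof R (ℤ × ℤ) O.shiftedSuspension.obj D).comp
      (φ - (pairing ((p 0).1, (p 0).2 - 1) ((i : ℤ), 1 - (i : ℤ))).negOnePow • ψ), fun z => ?_⟩
    rw [LinearMap.comp_apply, LinearMap.sub_apply, LinearMap.smul_apply, ← hφ, ← hψ, structureValue,
      arityOneMap, Function.update_self]
    congr 3
    rw [show Function.update (fun _ : Fin 1 => x 0) 0 z = fun _ : Fin 1 => z from
      funext fun v => by rw [Subsingleton.elim v 0, Function.update_self]]
  | j + 2 =>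
    set D : ℤ × ℤ := ∑ v, p v + ((i : ℤ), 2 - ((i : ℤ) + (j + 2 : ℕ))) with hD
    obtain ⟨φ, hφ⟩ := O.suspension.exists_brace_update_eq (O.multiplication m i)
      (fun v => ((p v).1, (p v).2 - 1)) x (D.1, D.2 - 1)
      (by ext <;> simp [hD, Prod.fst_sum, Prod.snd_sum] <;> ring) v
    refine ⟨(DirectSum.lof R (ℤ × ℤ) O.shiftedSuspension.obj D).comp
      ((∑ v : Fin (j + 2), (((j + 2 : ℕ) : ℤ) - (v + 1)) * ((p v).2 - 1)).negOnePow • φ), fun z => ?_⟩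
    rw [LinearMap.comp_apply, LinearMap.smul_apply, ← hφ, structureValue, higherMap]

/-- The structure map `M_{ij}`. -/
noncomputable def structureMap (i j : ℕ) :
    MultilinearMap R (fun _ : Fin j => O.shiftedSuspension.Total) O.shiftedSuspension.Total :=
  MultilinearMap.fromDirectSumEquiv fun p =>
    multilinearOfExists (O.structureValue m i j p) (O.exists_structureValue_update_eq m i j p)

theorem structureMap_hom (i j : ℕ) (p : Fin j → ℤ × ℤ) (x : ∀ v, O.shiftedSuspension.obj (p v)) :
    O.structureMap m i j (fun v => O.shiftedSuspension.hom (p v) (x v)) =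
      O.structureValue m i j p x :=
  MultilinearMap.fromDirectSumEquiv_lof (κ := fun _ : Fin j => ℤ × ℤ)
    (M := fun _ => O.shiftedSuspension.obj) _ p x

theorem structureMap_zero (i : ℕ) : O.structureMap m i 0 = 0 := by
  refine MultilinearMap.directSum_ext fun p => MultilinearMap.ext fun x => ?_
  exact O.structureMap_hom m i 0 p x

/-- The degree of a value of a structure map. -/
theorem exists_structureValue_eq_hom (i j : ℕ) (p : Fin j → ℤ × ℤ)
    (x : ∀ v, O.shiftedSuspension.obj (p v)) :
    ∃ y : O.shiftedSuspension.obj (∑ v, p v + ((i : ℤ), 2 - ((i : ℤ) + j))),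
      O.structureValue m i j p x = O.shiftedSuspension.hom _ y := by
  match j with
  | 0 => exact ⟨0, (map_zero _).symm⟩
  | 1 =>
    have h : p 0 + ((i : ℤ), 2 - ((i : ℤ) + 1)) = ∑ v, p v + ((i : ℤ), 2 - ((i : ℤ) + (1 : ℕ))) := by
      simp
    rw [← h]
    exact ⟨_, rfl⟩
  | j + 2 => exact ⟨_, rfl⟩

end BigradedOperad

namespace BigradedOperad

open InsertionSystem Finset
variable {R : Type v} [CommRing R]

/-! ### The relations of the multiplication -/

variable (O : BigradedOperad.{u} R) (m : O.DerivedAInftyMultiplication)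

/-- The image of the class of an expression. -/
def exprImage {n : ℕ} {p : ℤ × ℤ} (x : DAInfty.Expr R n p) : O.obj n p :=
  m.map (n := n) (p := p) (DAInfty.mk x)

theorem exprImage_smul {n : ℕ} {p : ℤ × ℤ} (c : R) (x : DAInfty.Expr R n p) :
    O.exprImage m (x.smul c) = c • O.exprImage m x :=
  map_smul m.map c (DAInfty.mk x : (dAInfty R).obj n p)

theorem exprImage_listSum {n : ℕ} {p : ℤ × ℤ} (L : List (DAInfty.Expr R n p)) :
    O.exprImage m (DAInfty.Expr.listSum L) = (L.map (O.exprImage m)).sum := by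
  induction L with
  | nil => exact map_zero m.map
  | cons x L ih =>
    rw [List.map_cons, List.sum_cons, ← ih]
    exact map_add m.map (DAInfty.mk x : (dAInfty R).obj n p)
      (DAInfty.mk (DAInfty.Expr.listSum L) : (dAInfty R).obj n p)

/-- The image of a generator. -/
def genImage (i j : ℕ) (hj : 1 ≤ j) : O.obj j ((i : ℤ), 2 - ((i : ℤ) + j)) :=
  m.map (dAInfty.gen R i j hj rfl)

/-- The derived `A_∞`-relation between the images of the generators. -/
theorem sum_circ_genImage_eq_zero (u v : ℕ) (hv : 1 ≤ v) :
    ∑ i : Fin (u + 1), ∑ r : Fin v, ∑ q : Fin (v - r),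
      ((-1 : R) ^ ((r : ℕ) * (q + 1) + (v - r - (q + 1)) + (u - i) * (r + 1 + (v - r - (q + 1))))) •
        O.circ (k := v) (s := ((u : ℤ), 3 - ((u : ℤ) + v))) (by have := r.2; have := q.2; omega) ⟨r, by omega⟩
          (by have := i.2; have := r.2; have := q.2; ext <;> simp <;> omega)
          (O.genImage m (i : ℕ) (r + 1 + (v - r - (q + 1))) (by omega))
          (O.genImage m (u - i) (q + 1) (by omega)) = 0 := by
  have h : O.exprImage m (DAInfty.relator R u v) = 0 :=
    (congrArg m.map (Quot.sound (DAInfty.Rel.relation u v hv))).trans (map_zero m.map)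
  rw [DAInfty.relator, exprImage_listSum] at h
  rw [← h]
  simp only [List.flatMap_def, List.map_flatten, List.sum_flatten, List.map_map, Function.comp_def, Fin.sum_univ_def]
  refine congrArg List.sum (List.map_congr_left fun i _ => ?_)
  refine congrArg List.sum (List.map_congr_left fun r _ => ?_)
  refine congrArg List.sum (List.map_congr_left fun q _ => ?_)
  rw [exprImage_smul]
  exact congrArg _ (m.map_circ _ _ _ _ _).symm

theorem circ_congr_degree {n m k : ℕ} (hk : k + 1 = n + m) (i : Fin n) {p q s s' : ℤ × ℤ}
    (hs : s = p + q) (hs' : s' = p + q) (x : O.obj n p) (y : O.obj m q) :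
    O.circ hk i hs x y = O.castLinear rfl (hs'.trans hs.symm) (O.circ hk i hs' x y) := by
  subst hs hs'; rfl

/-- Insertions of generators in any presentation of their bidegrees. -/
theorem circ_map_gen {n l k : ℕ} (hk : k + 1 = n + l) (r : Fin n) (i j : ℕ) (hn : 1 ≤ n) (hl : 1 ≤ l)
    {p q s s' : ℤ × ℤ} (hp : p = ((i : ℤ), 2 - ((i : ℤ) + n))) (hq : q = ((j : ℤ), 2 - ((j : ℤ) + l)))
    (hs : s = p + q) (hs' : s' = ((i : ℤ), 2 - ((i : ℤ) + n)) + ((j : ℤ), 2 - ((j : ℤ) + l))) :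
    O.circ hk r hs (m.map (dAInfty.gen R i n hn hp)) (m.map (dAInfty.gen R j l hl hq)) =
      O.castLinear rfl (by rw [hs, hs', hp, hq])
        (O.circ hk r hs' (O.genImage m i n hn) (O.genImage m j l hl)) := by
  subst hp hq
  exact O.circ_congr_degree hk r hs hs' _ _

theorem neg_one_pow_smul {M : Type*} [AddCommGroup M] [Module R M] (n : ℕ) (x : M) :
    (-1 : R) ^ n • x = (n : ℤ).negOnePow • x := by
  rw [Units.smul_def, ← Int.cast_smul_eq_zsmul R, Int.coe_negOnePow_natCast]
  simp

/-- In `𝔰O` the signs `(-1)^{rq + t + pj}` of the derived `A_∞`-relation reduce to `(-1)^p`. -/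
theorem sum_circ_multiplication_eq_zero (u v : ℕ) (hv : 1 ≤ v) :
    ∑ i : Fin (u + 1), ∑ r : Fin v, ∑ q : Fin (v - r),
      (((u - i : ℕ) : ℤ)).negOnePow •
        O.suspension.circ (k := v) (s := ((u : ℤ), 2 - (u : ℤ))) (by have := r.2; have := q.2; omega)
          ⟨r, by omega⟩ (by have := i.2; ext <;> simp <;> omega)
          (O.multiplication m i (r + 1 + (v - r - (q + 1))))
          (O.multiplication m (u - i) (q + 1)) = 0 := by
  have h := congrArg (O.castLinear rfl (show ((u : ℤ), 3 - ((u : ℤ) + v)) =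
    ((u : ℤ), 2 - (u : ℤ) + 1 - v) by ext <;> simp; ring)) (O.sum_circ_genImage_eq_zero m u v hv)
  rw [map_zero] at h
  rw [← h]
  simp only [map_sum, map_smul]
  refine sum_congr rfl fun i _ => sum_congr rfl fun r _ => sum_congr rfl fun q _ => ?_
  have hi := i.2; have hr := r.2; have hq := q.2
  rw [LinearMap.smul_apply, LinearMap.smul_apply, multiplication, dif_pos (by omega), multiplication, dif_pos (by omega),
    circ_map_gen (s' := ((u : ℤ), 3 - ((u : ℤ) + v))), smul_smul, neg_one_pow_smul]
  · congr 1
    rw [← Int.negOnePow_add, Int.negOnePow_eq_iff]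
    obtain ⟨p, hp⟩ : ∃ p, u - i = p := ⟨_, rfl⟩
    obtain ⟨t, ht⟩ : ∃ t, v - r - (q + 1) = t := ⟨_, rfl⟩
    rw [hp, ht]
    push_cast
    exact ⟨-(p * r) - p * t - r * q, by ring⟩
  · ext <;> simp <;> omega

end BigradedOperad

namespace InsertionSystem
open Finset
variable {T : Type u} [AddCommGroup T] {S : InsertionSystem T}

/-- The square `x{y}` in one arity `v`, for a family `y` without component of arity zero. -/
theorem brace_singleton_apply {x y : ℕ →₀ T} (d : ℤ × ℤ) (hy : y 0 = 0) {v K : ℕ} (hv : v + 1 < K) :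
    S.brace [(d, y)] x v =
      ∑ r ∈ range v, ∑ q ∈ range (v - r), S.circ r (x (r + 1 + (v - r - (q + 1)))) (y (q + 1)) := by
  rw [brace_apply_apply _ _ (K := K) (by simpa using hv)]
  trans ∑ N ∈ range (v + 1), ∑ r ∈ range N, S.circ r (x N) (y (v + 1 - N))
  · symm
    refine sum_subset_zero_on_sdiff (fun N hN => ?_) (fun N hN => ?_) fun N hN => ?_
    · simp only [mem_range] at hN ⊢; omega
    · simp only [mem_sdiff, mem_range] at hN
      rw [insertFrom_cons_apply _ _ _ _ _ (K := K) (by simpa using hv)]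
      refine sum_eq_zero fun a _ => sum_eq_zero fun r hr => ?_
      rw [mem_Ico] at hr
      rw [insertFrom_nil, Finsupp.single_apply]
      split_ifs with h
      · obtain rfl : a = 0 := by omega
        simp [hy]
      · rfl
    · symm
      rw [mem_range] at hN
      rw [insertFrom_cons_apply _ _ _ _ _ (K := K) (by simpa using hv),
        sum_eq_single_of_mem (v + 1 - N) (by simp; omega)]
      · rw [Nat.Ico_zero_eq_range]
        refine sum_congr rfl fun r hr => ?_
        rw [mem_range] at hr
        rw [insertFrom_nil, Finsupp.single_apply, if_pos (by omega)]
      · intro a _ ha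
        refine sum_eq_zero fun r hr => ?_
        rw [mem_Ico] at hr
        rw [insertFrom_nil, Finsupp.single_apply, if_neg (by omega)]
  · rw [sum_sigma', sum_sigma']
    refine sum_nbij' (fun a => ⟨a.2, v - a.1⟩) (fun a => ⟨v - a.2, a.1⟩) ?_ ?_ ?_ ?_ ?_
    · rintro ⟨N, r⟩ h; simp only [mem_sigma, mem_range] at h ⊢; omega
    · rintro ⟨N, r⟩ h; simp only [mem_sigma, mem_range] at h ⊢; omega
    · rintro ⟨N, r⟩ h; simp only [mem_sigma, mem_range] at h ⊢
      rw [show v - (v - N) = N by omega]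
    · rintro ⟨N, r⟩ h; simp only [mem_sigma, mem_range] at h ⊢
      rw [show v - (v - r) = r by omega]
    · rintro ⟨N, r⟩ h; simp only [mem_sigma, mem_range] at h ⊢
      rw [show r + 1 + (v - r - (v - N + 1)) = N by omega, show v - N + 1 = v + 1 - N by omega]

theorem operation_apply_congr {μ : Family T} {L L' : List (Family T)} {K : ℕ}
    (hL : List.Forall₂ (fun y y' : Family T => y.1 = y'.1 ∧ ∀ a < K, y.2 a = y'.2 a) L L') {k : ℕ}
    (h : k + L.length + 1 < K) : (S.operation μ L).2 k = (S.operation μ L').2 k := by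
  have hb : S.brace L μ.2 k = S.brace L' μ.2 k :=
    brace_apply_congr (hL.imp fun _ _ h => h.2) (fun _ _ => rfl) (by omega)
  have hc : S.correction μ L k = S.correction μ L' k := by
    rw [correction, correction, hL.length_eq]
    split_ifs with h₁
    · cases hL with
      | nil => simp at h₁
      | @cons y y' L L' hy hL =>
        obtain rfl : L' = [] := by simpa using h₁
        obtain rfl : L = [] := by simpa using hL
        rw [Finsupp.neg_apply, Finsupp.neg_apply, finsupp_unit_smul_apply, finsupp_unit_smul_apply,
          totalDegree_cons, totalDegree_cons, hy.1, List.headD_cons, List.headD_cons,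
          brace_apply_congr (List.forall₂_same.2 fun _ _ _ _ => rfl) hy.2 (by simpa using by omega)]
    · rfl
  rw [operation, operation, Finsupp.add_apply, Finsupp.add_apply, hb, hc]

/-- Operations are homogeneous in each variable with respect to signs. -/
theorem operation_unit_smul (μ : Family T) (L L' : List (Family T)) (d : ℤ × ℤ) (e : ℤˣ) (y : ℕ →₀ T) :
    (S.operation μ (L ++ (d, e • y) :: L')).2 = e • (S.operation μ (L ++ (d, y) :: L')).2 := by
  obtain ⟨φ, hφ⟩ := S.exists_brace_eq L L' μ.2
  have hb : S.brace (L ++ (d, e • y) :: L') μ.2 = e • S.brace (L ++ (d, y) :: L') μ.2 := by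
    rw [hφ, hφ, zsmul_unit_map]
  have hc : S.correction μ (L ++ (d, e • y) :: L') = e • S.correction μ (L ++ (d, y) :: L') := by
    rw [correction, correction]
    by_cases h : (L ++ (d, y) :: L').length = 1
    · obtain rfl : L = [] := by
        rw [← List.length_eq_zero_iff]; simp at h; omega
      rw [if_pos h, if_pos (by simpa using h), smul_neg, smul_comm e]
      simp
    · rw [if_neg h, if_neg (by simpa using h), smul_zero]
  rw [operation, operation, hb, hc, smul_add]

end InsertionSystem

namespace BigradedOperad

open InsertionSystem Finset
variable {R : Type v} [CommRing R]
variable (O : BigradedOperad.{u} R) (m : O.DerivedAInftyMultiplication)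

/-- The components of arity below `K` of `∑_l m_{il}`. -/
noncomputable def truncatedMultiplication (K i : ℕ) : Family O.suspension.Elements :=
  O.suspension.truncation K (O.multiplication m i)

/-- The relations of the generators say that `∑_{i + p = u} (-1)^p m_i{m_p} = 0` for
`m_i = ∑_l m_{il}`. -/
theorem sum_brace_truncatedMultiplication_eq_zero (K u v : ℕ) (hv : v + 1 < K) :
    ∑ ip ∈ antidiagonal u, (ip.2 : ℤ).negOnePow •
      O.suspension.insertionSystem.brace [O.truncatedMultiplication m K ip.2]
        (O.truncatedMultiplication m K ip.1).2 v = 0 := by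
  rcases Nat.eq_zero_or_pos v with rfl | hv₁
  · refine sum_eq_zero fun ip _ => ?_
    rw [truncatedMultiplication, truncation, brace_singleton_apply _ _ hv]
    · simp
    · rw [truncate_apply, if_pos (by omega)]
      exact map_zero _
  have h := congrArg (O.suspension.incl v ((u : ℤ), 2 - (u : ℤ)))
    (O.sum_circ_multiplication_eq_zero m u v hv₁)
  rw [map_zero] at h
  rw [← h]
  rw [Nat.sum_antidiagonal_eq_sum_range_succ_mk, sum_range, map_sum]
  refine sum_congr rfl fun i _ => ?_
  simp only
  rw [truncatedMultiplication, truncation, brace_singleton_apply _ _ hv]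
  · rw [map_sum, smul_sum, sum_range]
    refine sum_congr rfl fun r _ => ?_
    rw [map_sum, smul_sum, sum_range]
    refine sum_congr rfl fun q _ => ?_
    have hr := r.2; have hq := q.2
    rw [zsmul_unit_map, truncate_apply, if_pos (by omega), truncatedMultiplication,
      O.suspension.truncation_apply _ (by omega)]
    refine congrArg _ ?_
    exact O.suspension.circTotal_incl (k := v) (by omega) (by omega)
      (by have := i.2; ext <;> simp <;> omega) (O.multiplication m i (r + 1 + (v - r - (q + 1))))
      (O.multiplication m (u - i) (q + 1))
  · rw [truncate_apply, if_pos (by omega)]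
    exact map_zero _

/-! ### Components of elements of the shifted suspension -/

/-- The component of arity `k` of the elements of `S𝔰O`. -/
noncomputable def component (k : ℕ) : O.shiftedSuspension.Total →+ O.suspension.Elements :=
  DirectSum.toAddMonoid fun p : ℤ × ℤ => (O.suspension.incl k (p.1, p.2 - 1)).comp
    (Pi.evalAddMonoidHom (fun n => O.suspension.obj n (p.1, p.2 - 1)) k)

theorem component_hom (k : ℕ) (p : ℤ × ℤ) (x : O.shiftedSuspension.obj p) :
    O.component k (O.shiftedSuspension.hom p x) = O.suspension.incl k (p.1, p.2 - 1) (x k) :=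
  DirectSum.toAddMonoid_of _ _ _

/-- Components determine the element: the one of arity `k` and bidegree `p` is read off
from `component k` at the unshifted bidegree. -/
theorem component_apply (k : ℕ) (v : O.shiftedSuspension.Total) (p : ℤ × ℤ) :
    O.component k v (k, (p.1, p.2 - 1)) = v p k := by
  induction v using DirectSum.induction_on with
  | zero => rw [map_zero]; rfl
  | of q x =>
    refine (congrArg (fun w : O.suspension.Elements => w (k, (p.1, p.2 - 1)))
      (O.component_hom k q x)).trans ?_
    by_cases h : q = p
    · subst h
      rw [DirectSum.of_eq_same]
      exact DirectSum.of_eq_same _ _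
    · rw [DirectSum.of_eq_of_ne _ _ _ (Ne.symm h)]
      refine DirectSum.of_eq_of_ne _ _ _ fun h' => h ?_
      simp only [Prod.mk.injEq, true_and] at h'
      ext
      · exact h'.1.symm
      · have := h'.2; omega
  | add v w hv hw =>
    rw [map_add]
    exact (congrArg₂ (· + ·) hv hw)

theorem eq_zero_of_component_eq_zero (v : O.shiftedSuspension.Total)
    (h : ∀ k, O.component k v = 0) : v = 0 := by
  refine DFinsupp.ext fun p => funext fun k => ?_
  rw [← O.component_apply, h]
  rfl

/-- The components of the values of `M_{ij}` in terms of truncated families. -/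
theorem component_structureValue (i j : ℕ) (hj : 1 ≤ j) (p : Fin j → ℤ × ℤ)
    (x : ∀ v, O.shiftedSuspension.obj (p v)) {k K : ℕ} (hK : k + j < K) :
    O.component k (O.structureValue m i j p x) =
      (∑ v : Fin j, ((j : ℤ) - (v + 1)) * ((p v).2 - 1)).negOnePow •
        (O.suspension.insertionSystem.operation (O.truncatedMultiplication m K i)
          (List.ofFn fun v => O.suspension.truncation (p := ((p v).1, (p v).2 - 1)) K (x v))).2 k := by
  match j with
  | 1 =>
    rw [structureValue, component_hom, arityOneMap, Units.smul_def, Pi.sub_apply, Pi.smul_apply,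
      map_sub, map_zsmul, O.suspension.incl_brace (K := K) _ _ _ _ _ hK,
      O.suspension.incl_brace (K := K) _ _ _ _ _ hK]
    simp [operation, correction, truncatedMultiplication, sub_eq_add_neg, truncation, Units.smul_def]
  | j + 2 =>
    rw [structureValue, component_hom, higherMap, Units.smul_def, Pi.smul_apply, map_zsmul,
      O.suspension.incl_brace (K := K) _ _ _ _ _ hK, operation, correction, if_neg (by simp), add_zero,
      Units.smul_def]
    rfl

end BigradedOperad

namespace BigradedOperad

open InsertionSystem Finset
variable {R : Type v} [CommRing R]

/-! ### The derived `A_∞`-algebra -/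

theorem sum_antidiagonalTuple_three {M : Type*} [AddCommMonoid M] (c : ℕ) (f : ℕ → ℕ → ℕ → M) :
    ∑ rqt ∈ (Finset.Nat.antidiagonalTuple 3 c).filter (fun rqt => 1 ≤ rqt 1),
      f (rqt 0) (rqt 1) (rqt 2) =
    ∑ r ∈ range c, ∑ q ∈ range (c - r), f r (q + 1) (c - r - (q + 1)) := by
  rw [sum_sigma']
  refine sum_nbij' (fun a => ⟨a 0, a 1 - 1⟩) (fun a => ![a.1, a.2 + 1, c - a.1 - (a.2 + 1)])
    ?_ ?_ ?_ ?_ ?_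
  · intro a h
    simp only [mem_filter, Nat.mem_antidiagonalTuple, Fin.sum_univ_three, mem_sigma, mem_range] at h ⊢
    omega
  · intro a h
    simp only [mem_sigma, mem_range] at h
    simp only [mem_filter, Nat.mem_antidiagonalTuple, Fin.sum_univ_three]
    simp
    omega
  · intro a h
    simp only [mem_filter, Nat.mem_antidiagonalTuple, Fin.sum_univ_three] at h
    ext v
    fin_cases v <;> simp <;> omega
  · intro a h
    simp
  · intro a h
    simp only [mem_filter, Nat.mem_antidiagonalTuple, Fin.sum_univ_three] at h
    simp only
    congr 1 <;> omega

/-- The list of the arguments of the outer map in a composite. -/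
theorem ofFn_substitute {α : Type*} (f : ℕ → α) (g : α) (r q t : ℕ) :
    List.ofFn (fun a : Fin (r + 1 + t) => if (a : ℕ) < r then f a else if (a : ℕ) = r then g
      else f (a - 1 + q)) =
    ((List.range (r + q + t)).map f).take r ++ g :: ((List.range (r + q + t)).map f).drop (r + q) := by
  refine List.ext_getElem (by simp; omega) fun n h₁ h₂ => ?_
  rw [List.length_ofFn] at h₁
  simp only [List.getElem_ofFn, List.getElem_append, List.length_take, List.length_map,
    List.length_range, List.getElem_take, List.getElem_map, List.getElem_range, List.getElem_cons,
    List.getElem_drop]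
  have h : min r (r + q + t) = r := by omega
  simp only [h]
  split_ifs <;> first | rfl | omega | (congr 1; omega)

theorem ofFn_eq_take_drop {α : Type*} (f : ℕ → α) (r q t : ℕ) :
    List.ofFn (fun a : Fin q => f (r + a)) = (((List.range (r + q + t)).map f).drop r).take q := by
  refine List.ext_getElem (by simp; omega) fun n h₁ h₂ => ?_
  simp

/-- How the exponents of the shift add up in a composite of two operations. -/
theorem sum_shift_exponents (e : ℕ → ℤ) (r q t : ℕ) (s : ℤ) :
    ∑ v ∈ range (r + 1 + t), (((r + 1 + t : ℕ) : ℤ) - (v + 1)) * (if v < r then e v else if v = r then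
        ∑ b ∈ range q, e (r + b) + s else e (v - 1 + q)) +
      ∑ v ∈ range q, ((q : ℤ) - (v + 1)) * e (r + v) =
    ∑ v ∈ range (r + q + t), (((r + q + t : ℕ) : ℤ) - (v + 1)) * e v -
      ((q : ℤ) - 1) * ∑ v ∈ range r, e v + t * s := by
  rw [sum_range_add, sum_range_succ, sum_range_add, sum_range_add]
  have h₁ : ∑ v ∈ range r, (((r + 1 + t : ℕ) : ℤ) - (v + 1)) * (if v < r then e v else if v = r then
      ∑ b ∈ range q, e (r + b) + s else e (v - 1 + q)) =
      ∑ v ∈ range r, (((r + q + t : ℕ) : ℤ) - (v + 1)) * e v - ((q : ℤ) - 1) * ∑ v ∈ range r, e v := by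
    rw [mul_sum, ← sum_sub_distrib]
    refine sum_congr rfl fun v hv => ?_
    rw [if_pos (mem_range.1 hv)]
    push_cast
    ring
  have h₂ : ∑ v ∈ range t, (((r + 1 + t : ℕ) : ℤ) - ((r + 1 + v : ℕ) + 1)) *
      (if r + 1 + v < r then e (r + 1 + v) else if r + 1 + v = r then
      ∑ b ∈ range q, e (r + b) + s else e (r + 1 + v - 1 + q)) =
      ∑ v ∈ range t, (((r + q + t : ℕ) : ℤ) - ((r + q + v : ℕ) + 1)) * e (r + q + v) := by
    refine sum_congr rfl fun v hv => ?_
    rw [if_neg (by omega), if_neg (by omega), show r + 1 + v - 1 + q = r + q + v by omega]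
    push_cast
    ring
  have h₃ : ∑ v ∈ range q, (((r + q + t : ℕ) : ℤ) - ((r + v : ℕ) + 1)) * e (r + v) =
      ∑ v ∈ range q, ((q : ℤ) - (v + 1)) * e (r + v) + t * ∑ v ∈ range q, e (r + v) := by
    rw [mul_sum, ← sum_add_distrib]
    refine sum_congr rfl fun v hv => ?_
    push_cast
    ring
  rw [h₁, h₂, h₃, if_neg (lt_irrefl _), if_pos rfl]
  push_cast
  ring

variable (O : BigradedOperad.{u} R) (m : O.DerivedAInftyMultiplication)

/-- The truncated family of a homogeneous element of `S𝔰O`. -/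
noncomputable def shiftedTruncation (K : ℕ) (x : Σ p, O.shiftedSuspension.obj p) :
    Family O.suspension.Elements :=
  O.suspension.truncation (p := (x.1.1, x.1.2 - 1)) K x.2

theorem totalDegree_map_range (K : ℕ) (X : ℕ → Σ p, O.shiftedSuspension.obj p) (n : ℕ) :
    totalDegree ((List.range n).map fun a => O.shiftedTruncation K (X a)) =
      (∑ a ∈ range n, (X a).1.1, ∑ a ∈ range n, ((X a).1.2 - 1)) := by
  induction n with
  | zero => rfl
  | succ n ih =>
    rw [List.range_succ, List.map_append, totalDegree_append, ih, sum_range_succ, sum_range_succ]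
    simp [shiftedTruncation, truncation]

theorem totalDegree_ofFn (K q : ℕ) (X : ℕ → Σ p, O.shiftedSuspension.obj p) :
    totalDegree (List.ofFn fun a : Fin q => O.shiftedTruncation K (X a)) =
      (∑ a ∈ range q, (X a).1.1, ∑ a ∈ range q, ((X a).1.2 - 1)) := by
  rw [← O.totalDegree_map_range K X q]
  congr 1
  refine List.ext_getElem (by simp) fun n h₁ h₂ => ?_
  simp

/-- The components of a composite `M_{ij}(1^r, M_{pq}, 1^t)` in terms of truncated families. -/
theorem component_structureMap_structureMap (i p r q t : ℕ) (hq : 1 ≤ q)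
    (X : ℕ → Σ p, O.shiftedSuspension.obj p) {k K : ℕ} (hK : k + r + q + t + 3 < K) :
    O.component k (O.structureMap m i (r + 1 + t) (fun a =>
      if (a : ℕ) < r then O.shiftedSuspension.hom (X a).1 (X a).2
      else if (a : ℕ) = r then
        O.structureMap m p q (fun e => O.shiftedSuspension.hom (X (r + e)).1 (X (r + e)).2)
      else O.shiftedSuspension.hom (X (a - 1 + q)).1 (X (a - 1 + q)).2)) =
    (∑ v ∈ range (r + q + t), (((r + q + t : ℕ) : ℤ) - (v + 1)) * ((X v).1.2 - 1) -
      ((q : ℤ) - 1) * ∑ v ∈ range r, ((X v).1.2 - 1) + t * (1 - (p : ℤ))).negOnePow •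
      (O.suspension.insertionSystem.operation (O.truncatedMultiplication m K i)
        (((List.range (r + q + t)).map fun a => O.shiftedTruncation K (X a)).take r ++
          O.suspension.insertionSystem.operation (O.truncatedMultiplication m K p)
            ((((List.range (r + q + t)).map fun a => O.shiftedTruncation K (X a)).drop r).take q) ::
          ((List.range (r + q + t)).map fun a => O.shiftedTruncation K (X a)).drop (r + q))).2 k := by
  obtain ⟨D, hD, z, hz⟩ : ∃ D, D = ∑ e : Fin q, (X (r + e)).1 + ((p : ℤ), 2 - ((p : ℤ) + q)) ∧
      ∃ z : O.shiftedSuspension.obj D, O.structureValue m p q (fun e => (X (r + e)).1)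
        (fun e => (X (r + e)).2) = O.shiftedSuspension.hom D z :=
    ⟨_, rfl, O.exists_structureValue_eq_hom m p q _ _⟩
  -- the arguments of the outer map
  let Z : ℕ → Σ p, O.shiftedSuspension.obj p := fun a =>
    if a < r then X a else if a = r then ⟨D, z⟩ else X (a - 1 + q)
  have hZ : (fun a : Fin (r + 1 + t) =>
      if (a : ℕ) < r then O.shiftedSuspension.hom (X a).1 (X a).2
      else if (a : ℕ) = r then
        O.structureMap m p q (fun e => O.shiftedSuspension.hom (X (r + e)).1 (X (r + e)).2)
      else O.shiftedSuspension.hom (X (a - 1 + q)).1 (X (a - 1 + q)).2) =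
      fun a : Fin (r + 1 + t) => O.shiftedSuspension.hom (Z a).1 (Z a).2 := by
    funext a
    by_cases h₁ : (a : ℕ) < r
    · rw [if_pos h₁, show Z a = X a from if_pos h₁]
    · by_cases h₂ : (a : ℕ) = r
      · rw [if_neg h₁, if_pos h₂, structureMap_hom, hz,
          show Z a = ⟨D, z⟩ from (if_neg h₁).trans (if_pos h₂)]
      · rw [if_neg h₁, if_neg h₂,
          show Z a = X (a - 1 + q) from (if_neg h₁).trans (if_neg h₂)]
  have hlist : (List.ofFn fun a : Fin (r + 1 + t) => O.shiftedTruncation K (Z a)) =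
      ((List.range (r + q + t)).map fun a => O.shiftedTruncation K (X a)).take r ++
        O.shiftedTruncation K ⟨D, z⟩ ::
          ((List.range (r + q + t)).map fun a => O.shiftedTruncation K (X a)).drop (r + q) := by
    rw [← ofFn_substitute]
    congr 1
    funext a
    simp only [Z]
    split_ifs <;> rfl
  have hinner : (List.ofFn fun e : Fin q => O.shiftedTruncation K (X (r + e))) =
      (((List.range (r + q + t)).map fun a => O.shiftedTruncation K (X a)).drop r).take q :=
    ofFn_eq_take_drop (fun a => O.shiftedTruncation K (X a)) r q t
  have hdeg : D.2 - 1 = ∑ e ∈ range q, ((X (r + e)).1.2 - 1) + (1 - (p : ℤ)) := by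
    rw [hD, sum_sub_distrib, sum_range]
    simp [Prod.snd_sum]
    ring
  rw [hZ, structureMap_hom, O.component_structureValue m i _ (by omega) _ _ (K := K) (by omega)]
  change _ • (O.suspension.insertionSystem.operation _
    (List.ofFn fun a : Fin (r + 1 + t) => O.shiftedTruncation K (Z a))).2 k = _
  rw [hlist, operation_apply_congr (K := K - q)
    -- components of arity below `K - q` of the inner map are computed correctly after truncation at `K`
    (L' := ((List.range (r + q + t)).map fun a => O.shiftedTruncation K (X a)).take r ++
      ((O.suspension.insertionSystem.operation (O.truncatedMultiplication m K p)
        ((((List.range (r + q + t)).map fun a => O.shiftedTruncation K (X a)).drop r).take q)).1,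
       (∑ v : Fin q, ((q : ℤ) - (v + 1)) * ((X (r + v)).1.2 - 1)).negOnePow •
        (O.suspension.insertionSystem.operation (O.truncatedMultiplication m K p)
        ((((List.range (r + q + t)).map fun a => O.shiftedTruncation K (X a)).drop r).take q)).2) ::
      ((List.range (r + q + t)).map fun a => O.shiftedTruncation K (X a)).drop (r + q)),
    operation_unit_smul, finsupp_unit_smul_apply, smul_smul, ← Int.negOnePow_add,
    ← sum_range (fun v => (((r + 1 + t : ℕ) : ℤ) - (v + 1)) * ((Z v).1.2 - 1)),
    ← sum_range (fun v => ((q : ℤ) - (v + 1)) * ((X (r + v)).1.2 - 1)),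
    ← sum_shift_exponents (fun a => (X a).1.2 - 1)]
  · congr 3
    refine sum_congr rfl fun v _ => ?_
    congr 1
    simp only [Z]
    split_ifs
    · rfl
    · exact hdeg
    · rfl
  · refine List.rel_append (List.forall₂_same.2 fun _ _ => ⟨rfl, fun _ _ => rfl⟩)
      (List.Forall₂.cons ⟨?_, fun a ha => ?_⟩ (List.forall₂_same.2 fun _ _ => ⟨rfl, fun _ _ => rfl⟩))
    · rw [← hinner, operation, O.totalDegree_ofFn K q (fun e => X (r + e))]
      have h₁ : D.1 = ∑ e ∈ range q, (X (r + e)).1.1 + (p : ℤ) := by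
        rw [hD, sum_range]
        simp [Prod.fst_sum]
      change (D.1, D.2 - 1) = ((p : ℤ), 1 - (p : ℤ)) + _
      rw [h₁, hdeg, Prod.mk_add_mk, add_comm, add_comm (1 - (p : ℤ))]
    · rw [← hinner, finsupp_unit_smul_apply, shiftedTruncation, truncation_apply _ _ (by omega)]
      rw [← O.component_hom, ← hz, O.component_structureValue m p q hq _ _ (K := K) (by omega)]
      rfl
  · simp
    omega

/-- The derived `A_∞`-algebra structure on `S𝔰O`. -/
noncomputable def derivedAInftyAlgebra : DerivedAInftyAlgebra O.shiftedSuspension where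
  map := O.structureMap m
  map_arity_zero := O.structureMap_zero m
  bidegree i j p x := by
    obtain ⟨y, hy⟩ := O.exists_structureValue_eq_hom m i j p x
    exact ⟨y, (O.structureMap_hom m i j p x).trans hy⟩
  relation b c hc d x := by
    refine O.eq_zero_of_component_eq_zero _ fun k => ?_
    let X : ℕ → Σ p, O.shiftedSuspension.obj p := fun a => ⟨d a, x a⟩
    -- a truncation that does not affect the component of arity `k` of composites
    set K := k + c + 4 with hK
    set L := (List.range c).map fun a => O.shiftedTruncation K (X a) with hL
    have hlen : L.length = c := by simp [hL]
    have main := sum_operation_operation_eq_zero (S := O.suspension.insertionSystem)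
      (μ := O.truncatedMultiplication m K) (fun i => O.suspension.isHomogeneous_truncation K _)
      (fun i => rfl) (u := b) (K := K - 1)
      (fun v hv => O.sum_brace_truncatedMultiplication_eq_zero m K b v (by omega))
      (L := L) (fun y hy => by
        obtain ⟨a, _, rfl⟩ := List.mem_map.1 hy
        exact O.suspension.isHomogeneous_truncation K _) (by omega) (k := k) (by omega)
    rw [hlen] at main
    refine Eq.trans ?_ ((congrArg ((∑ v ∈ range c, ((c : ℤ) - (v + 1)) * ((d v).2 - 1)).negOnePow • ·)
      main).trans (smul_zero _))
    rw [map_sum, smul_sum]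
    refine sum_congr rfl fun ip _ => ?_
    rw [sum_antidiagonalTuple_three c fun r q t =>
      ((-1 : R) ^ (r * q + t + ip.2 * (r + 1 + t))) •
        (pairing ((ip.2 : ℤ), 2 - ((ip.2 : ℤ) + q)) (∑ a ∈ Finset.range r, d a)).negOnePow •
          O.structureMap m ip.1 (r + 1 + t) (fun a =>
            if (a : ℕ) < r then O.shiftedSuspension.hom (d a) (x a)
            else if (a : ℕ) = r then
              O.structureMap m ip.2 q (fun e => O.shiftedSuspension.hom (d (r + e)) (x (r + e)))
            else O.shiftedSuspension.hom (d (a - 1 + q)) (x (a - 1 + q))), map_sum, smul_sum]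
    refine sum_congr rfl fun r hr => ?_
    rw [map_sum, smul_sum]
    refine sum_congr rfl fun q hq => ?_
    rw [mem_range] at hr hq
    obtain ⟨t, rfl⟩ : ∃ t, c = r + (q + 1) + t := ⟨c - r - (q + 1), by omega⟩
    rw [show r + (q + 1) + t - r - (q + 1) = t by omega, neg_one_pow_smul, zsmul_unit_map,
      zsmul_unit_map]
    have h := O.component_structureMap_structureMap m ip.1 ip.2 r (q + 1) t (by omega) X (k := k)
      (K := K) (by omega)
    have hdeg : totalDegree (L.take r) = (∑ a ∈ range r, (d a).1, ∑ a ∈ range r, ((d a).2 - 1)) := by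
      rw [← O.totalDegree_map_range K X r, hL, ← List.map_take, List.take_range]
      congr 3
      omega
    rw [hdeg]
    refine (congrArg _ (congrArg _ h)).trans ?_
    simp only [smul_smul, ← Int.negOnePow_add]
    rw [← hL]
    congr 1
    rw [Int.negOnePow_eq_iff]
    simp only [X, truncatedMultiplication, truncation, pairing, Prod.fst_sum, Prod.snd_sum,
      sum_sub_distrib, sum_const, card_range, nsmul_eq_mul, mul_one]
    push_cast
    exact ⟨r * (q + 1) + t + (1 - (q + 1)) * ∑ a ∈ range r, (d a).2, by ring⟩

end BigradedOperad

end DerivedOperad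

theorem mainTheorem3 {R : Type v} [CommRing R] (O : DerivedOperad.BigradedOperad.{u} R)
    (hO : O.HorizontallyBounded) (m : O.DerivedAInftyMultiplication) :
    ∃! M : DerivedOperad.DerivedAInftyAlgebra O.shiftedSuspension,
      (∀ i j : ℕ, 2 ≤ j → ∀ (p : Fin j → ℤ × ℤ) (x : ∀ v, O.shiftedSuspension.obj (p v)),
        M.map i j (fun v => O.shiftedSuspension.hom (p v) (x v)) =
          O.shiftedSuspension.hom _ (O.higherMap m i p x)) ∧
      (∀ (i : ℕ) (p : ℤ × ℤ) (x : O.shiftedSuspension.obj p),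
        M.map i 1 (fun _ => O.shiftedSuspension.hom p x) =
          O.shiftedSuspension.hom _ (O.arityOneMap m i p x)) := by
  refine ⟨O.derivedAInftyAlgebra m, ⟨fun i j hj p x => ?_, fun i p x => ?_⟩, fun M hM => ?_⟩
  · exact (O.structureMap_hom m i j p x).trans (O.structureValue_of_two_le m i j hj p x)
  · exact O.structureMap_hom m i 1 (fun _ => p) (fun _ => x)
  · refine DerivedOperad.DerivedAInftyAlgebra.ext ?_
    funext i j
    match j with
    | 0 => rw [M.map_arity_zero, DerivedOperad.DerivedAInftyAlgebra.map_arity_zero]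
    | 1 =>
      refine MultilinearMap.directSum_ext fun p => MultilinearMap.ext fun x => ?_
      refine Eq.trans ?_ (O.structureMap_hom m i 1 p x).symm
      refine Eq.trans ?_ (hM.2 i (p 0) (x 0))
      refine congrArg (M.map i 1) (funext fun v => ?_)
      rw [Subsingleton.elim v 0]
    | j + 2 =>
      refine MultilinearMap.directSum_ext fun p => MultilinearMap.ext fun x => ?_
      exact (hM.1 i (j + 2) (by omega) p x).trans (O.structureMap_hom m i (j + 2) p x).symm
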